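/- Let $n\ge 1$ and let $e_1,\dots,e_n$ be an orthonormal basis of $\mathbb{R}^n$. A set $X\subset\mathbb{R}^n$ is called unconditional if it is invariant under the orthogonal reflection through each hyperplane $e_i^\perp$, $i=1,\dots,n$. A convex body is a compact convex set with non-empty interior, $V$ denotes the volume (Lebesgue measure), and $h_K(u)=\max_{x\in K}\langle x,u\rangle$ is the support function of $K$. For unconditional convex bodies $K,L\subset\mathbb{R}^n$ and $\lambda\in(0,1)$, put $$(1-\lambda)\cdot K+_0\lambda\cdot L=\{x\in\mathbb{R}^n:\ \langle x,u\rangle\le h_K(u)^{1-\lambda}h_L(u)^{\lambda}\ \text{ for all } u\in S^{n-1}\}.$$ We write $K=K_1\oplus\dots\oplus K_m$ if $K$ is the Minkowski sum $K_1+\dots+K_m$ and the sets $K_1,\dots,K_m$ lie in pairwise orthogonal linear subspaces of $\mathbb{R}^n$. Two sets $X,Y$ are dilates if $Y=cX$ for some real $c>0$. **Proposition.** Let $K$ and $L$ be convex bodies in $\mathbb{R}^n$ that are unconditional with respect to $e_1,\dots,e_n$, and let $\lambda\in(0,1)$. Then $$V\bigl((1-\lambda)\cdot K+_0\lambda\cdot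 L\bigr)=V(K)^{1-\lambda}\,V(L)^{\lambda}$$ if and only if there are $m\ge 1$ and compact convex sets $K_1,\dots,K_m,L_1,\dots,L_m$, all unconditional with respect to $e_1,\dots,e_n$ and of dimension at least one, such that $K=K_1\oplus\dots\oplus K_m$, $L=L_1\oplus\dots\oplus L_m$, $\sum_{i=1}^m\dim K_i=n$, and $K_i$ and $L_i$ are dilates for each $i=1,\dots,m$. -/

import Mathlib

open scoped Pointwise

namespace LogBM

/-- A convex body: a compact convex set with non-empty interior. (The interior is not required
by Mathlib's `ConvexBody`.) -/
structure IsConvexBody {n : ℕ} (K : Set (EuclideanSpace ℝ (Fin n))) : Prop where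
  convex : Convex ℝ K
  isCompact : IsCompact K
  interior_nonempty : (interior K).Nonempty

/-- The support function `h_K(u) = sup {⟨x, u⟩ : x ∈ K}`. -/
noncomputable def supportFn {n : ℕ} (K : Set (EuclideanSpace ℝ (Fin n)))
    (u : EuclideanSpace ℝ (Fin n)) : ℝ :=
  sSup ((fun x => inner ℝ x u) '' K)

/-- The `L₀`-sum `(1 - t) · K +₀ t · L`, the set of all `x` with
`⟨x, u⟩ ≤ h_K(u)^(1 - t) h_L(u)^t` for every unit vector `u`. -/
noncomputable def logSum {n : ℕ} (t : ℝ) (K L : Set (EuclideanSpace ℝ (Fin n))) :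
    Set (EuclideanSpace ℝ (Fin n)) :=
  {x | ∀ u ∈ Metric.sphere (0 : EuclideanSpace ℝ (Fin n)) 1,
    inner ℝ x u ≤ supportFn K u ^ (1 - t) * supportFn L u ^ t}

/-- `X` is unconditional with respect to the orthonormal basis `e`: it is invariant under the
orthogonal reflection through each coordinate hyperplane `(e i)^⊥`. -/
def IsUnconditional {n : ℕ} (e : OrthonormalBasis (Fin n) ℝ (EuclideanSpace ℝ (Fin n)))
    (X : Set (EuclideanSpace ℝ (Fin n))) : Prop :=
  ∀ i, (Submodule.span ℝ {e i})ᗮ.reflection '' X = X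

/-- The dimension of a set: the dimension of its affine hull. -/
noncomputable def dim {n : ℕ} (X : Set (EuclideanSpace ℝ (Fin n))) : ℕ :=
  Module.finrank ℝ (vectorSpan ℝ X)

/-- `K = P 0 ⊕ ⋯ ⊕ P (m - 1)`: `K` is the Minkowski sum of the sets `P i`, and these lie in
pairwise orthogonal linear subspaces. -/
def IsOrthogonalSum {n m : ℕ} (K : Set (EuclideanSpace ℝ (Fin n)))
    (P : Fin m → Set (EuclideanSpace ℝ (Fin n))) : Prop :=
  (Pairwise fun i j => Submodule.span ℝ (P i) ⟂ Submodule.span ℝ (P j)) ∧ K = ∑ i, P i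

/-- `X` and `Y` are dilates: `Y = c X` for some `c > 0`. -/
def AreDilates {n : ℕ} (X Y : Set (EuclideanSpace ℝ (Fin n))) : Prop :=
  ∃ c : ℝ, 0 < c ∧ Y = c • X

end LogBM

/-! In coordinates an unconditional convex body is solid, so everything is decided on the positive
orthant. By Hölder, coordinatewise geometric means of points of `A` and `B` lie in the `L₀`-sum
(`geomMean_mem_piLogSum`). The Prékopa–Leindler inequality, made multiplicative by the substitution
`x = exp s`, bounds the volume of any measurable set of the orthant containing these means from
below by the geometric mean of the volumes.

Equality of volumes turns this into a Prékopa–Leindler inequality between the uniform probability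
measures on the orthant parts of `A`, `B` and the `L₀`-sum, valid for all test functions. Inserting
`exp (δ u)` and letting `δ → 0` gives a linear inequality between integrals. It is applied to
coordinate sums normalized by the barycenters `α`, `β`, with the quantitative slack in AM–GM added
to one test function. The slack must then integrate to zero, which puts `B` scaled by `β` inside `A`
scaled by `α` (`ae_mem_of_volume_eq`). By symmetry `B = d A` for a positive diagonal map `d`
(`eq_diagImage_of_volume_eq`).

Then `d ^ t A` lies in the `L₀`-sum and has the same volume, so the two coincide. At a boundary
point with positive coordinates, equality in Hölder forces a suitable outer normal to live on a
single level set of `d`. Hence `A` contains every point whose projections to the level sets of `d`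
are in `A` (`mem_of_levelProj_mem`), that is, `A` is the orthogonal sum of its level parts, and on
each of them `d` is a dilation. Conversely, for such `A`, testing the `L₀`-sum on vectors supported
in one level shows that it is exactly `d ^ t A`, whose volume is the required geometric mean. -/

open MeasureTheory Set
open scoped ENNReal

namespace LogBM

/-! ### Brunn–Minkowski and Prékopa–Leindler on the line -/

/-- The one-dimensional Brunn–Minkowski inequality for compact sets. -/
theorem add_volume_le_of_isCompact {t : ℝ} (ht0 : 0 < t) (ht1 : t < 1) {A B C : Set ℝ}
    (hA : IsCompact A) (hB : IsCompact B) (hA' : A.Nonempty) (hB' : B.Nonempty)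
    (h : ∀ a ∈ A, ∀ b ∈ B, (1 - t) * a + t * b ∈ C) :
    ENNReal.ofReal (1 - t) * volume A + ENNReal.ofReal t * volume B ≤ volume C := by
  have hs : 0 < 1 - t := by linarith
  -- The translates `(1 - t) A + t min B` and `(1 - t) max A + t B` both lie in `C` and share at
  -- most the point `(1 - t) max A + t min B`.
  set a := sSup A
  set b := sInf B
  have ha : a ∈ A := hA.sSup_mem hA'
  have hb : b ∈ B := hB.sInf_mem hB'
  have hvol : ∀ (r c : ℝ) (S : Set ℝ), 0 < r →
      volume ((fun x => r * x + c) '' S) = ENNReal.ofReal r * volume S := by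
    intro r c S hr
    have : (fun x => r * x + c) '' S = (fun x => x + c) '' (r • S) := by
      rw [← image_smul, image_image]; rfl
    rw [this, image_add_right, measure_preimage_add_right, Measure.addHaar_smul]
    simp [abs_of_pos hr]
  have hcpt : ∀ (r c : ℝ) (S : Set ℝ), IsCompact S →
      MeasurableSet ((fun x => r * x + c) '' S) := fun r c S hS =>
    (hS.image (by fun_prop)).measurableSet
  rw [← hvol (1 - t) (t * b) A hs, ← hvol t ((1 - t) * a) B ht0, ← measure_union₀]
  · refine measure_mono (union_subset ?_ ?_)
    · rintro _ ⟨x, hx, rfl⟩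
      exact h x hx b hb
    · rintro _ ⟨x, hx, rfl⟩
      simpa only [add_comm] using h a ha x hx
  · exact (hcpt _ _ _ hB).nullMeasurableSet
  · refine measure_mono_null (t := {(1 - t) * a + t * b}) ?_ (by simp)
    rintro _ ⟨⟨x, hx, rfl⟩, ⟨y, hy, hxy⟩⟩
    have h1 : x ≤ a := le_csSup hA.bddAbove hx
    have h2 : b ≤ y := csInf_le hB.bddBelow hy
    simp only at hxy
    have h3 := mul_le_mul_of_nonneg_left h1 hs.le
    have h4 := mul_le_mul_of_nonneg_left h2 ht0.le
    simp only [mem_singleton_iff]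
    linarith

/-- The one-dimensional Brunn–Minkowski inequality for measurable sets. -/
theorem add_volume_le {t : ℝ} (ht0 : 0 < t) (ht1 : t < 1) {A B C : Set ℝ}
    (hA : MeasurableSet A) (hB : MeasurableSet B) (hA' : A.Nonempty) (hB' : B.Nonempty)
    (h : ∀ a ∈ A, ∀ b ∈ B, (1 - t) * a + t * b ∈ C) :
    ENNReal.ofReal (1 - t) * volume A + ENNReal.ofReal t * volume B ≤ volume C := by
  have key : ∀ S : Set ℝ, MeasurableSet S →
      volume S = ⨆ K : {K : Set ℝ // K ⊆ S ∧ IsCompact K}, volume K.1 := by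
    intro S hS
    rw [hS.measure_eq_iSup_isCompact, iSup_subtype]
    simp only [iSup_and]
  have ne : ∀ S : Set ℝ, Nonempty {K : Set ℝ // K ⊆ S ∧ IsCompact K} := fun S =>
    ⟨⟨∅, empty_subset _, isCompact_empty⟩⟩
  obtain ⟨a, ha⟩ := hA'
  obtain ⟨b, hb⟩ := hB'
  have := ne A
  have := ne B
  rw [key A hA, key B hB, ENNReal.mul_iSup, ENNReal.mul_iSup]
  refine ENNReal.iSup_add_iSup_le fun K L => ?_
  -- The inner compact sets may be empty; adjoining `a` and `b` makes them nonempty and keeps them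
  -- inside `A` and `B`.
  refine le_trans ?_ (add_volume_le_of_isCompact ht0 ht1 (K.2.2.insert a) (L.2.2.insert b)
    (insert_nonempty _ _) (insert_nonempty _ _) (C := C) ?_)
  · gcongr <;> exact subset_insert _ _
  · intro x hx y hy
    exact h x (insert_subset ha K.2.1 hx) y (insert_subset hb L.2.1 hy)

/-- Layer-cake: since both suprema equal 1, the level sets of `f` and `g` at a height `0 < s < 1`
are both nonempty, so Brunn–Minkowski applies at that height; above 1 they are both empty. This
normalization is what yields an arithmetic mean on the left. -/
theorem add_lintegral_le_of_sup_one {t : ℝ} (ht0 : 0 < t) (ht1 : t < 1) {f g h : ℝ → ℝ}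
    (hf : Measurable f) (hg : Measurable g) (hh : Measurable h)
    (hf0 : 0 ≤ f) (hg0 : 0 ≤ g) (hh0 : 0 ≤ h) (hf1 : ∀ x, f x ≤ 1) (hg1 : ∀ x, g x ≤ 1)
    (hfs : ∀ s < 1, ∃ x, s < f x) (hgs : ∀ s < 1, ∃ x, s < g x)
    (H : ∀ x y, f x ^ (1 - t) * g y ^ t ≤ h ((1 - t) * x + t * y)) :
    ENNReal.ofReal (1 - t) * (∫⁻ x, ENNReal.ofReal (f x))
      + ENNReal.ofReal t * (∫⁻ x, ENNReal.ofReal (g x)) ≤ ∫⁻ x, ENNReal.ofReal (h x) := by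
  have hm : ∀ u : ℝ → ℝ, Measurable fun s : ℝ => volume {a | s < u a} := fun u =>
    Antitone.measurable fun a b hab => measure_mono fun x (hx : b < u x) => lt_of_le_of_lt hab hx
  rw [lintegral_eq_lintegral_meas_lt _ (.of_forall hf0) hf.aemeasurable,
    lintegral_eq_lintegral_meas_lt _ (.of_forall hg0) hg.aemeasurable,
    lintegral_eq_lintegral_meas_lt _ (.of_forall hh0) hh.aemeasurable,
    ← lintegral_const_mul _ (hm f), ← lintegral_const_mul _ (hm g), ← lintegral_add_left]
  · refine setLIntegral_mono (hm h) fun s hs => ?_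
    rcases lt_or_ge s 1 with h1 | h1
    · refine add_volume_le ht0 ht1 (measurableSet_lt measurable_const hf)
        (measurableSet_lt measurable_const hg) (hfs s h1) (hgs s h1) fun a ha b hb => ?_
      refine lt_of_lt_of_le ?_ (H a b)
      have hs : (0 : ℝ) < s := hs
      calc s = s ^ (1 - t) * s ^ t := by
            rw [← Real.rpow_add hs]; simp
        _ < f a ^ (1 - t) * g b ^ t := by
            apply mul_lt_mul'' <;> first | positivity | skip
            · exact Real.rpow_lt_rpow hs.le ha (by linarith)
            · exact Real.rpow_lt_rpow hs.le hb ht0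
    · have e : ∀ u : ℝ → ℝ, (∀ x, u x ≤ 1) → volume {a | s < u a} = 0 := by
        intro u hu
        have : {a | s < u a} = ∅ := by
          ext x; simpa using (hu x).trans h1
        rw [this, measure_empty]
      simp [e f hf1, e g hg1]
  · exact (hm f).const_mul _

theorem ennreal_geom_mean_le {t : ℝ} (ht0 : 0 < t) (ht1 : t < 1) (a b : ℝ≥0∞) :
    a ^ (1 - t) * b ^ t ≤ ENNReal.ofReal (1 - t) * a + ENNReal.ofReal t * b := by
  have hs : 0 < 1 - t := by linarith
  have hp : (1 - t)⁻¹.HolderConjugate t⁻¹ := by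
    rw [Real.holderConjugate_iff]
    refine ⟨(one_lt_inv₀ hs).2 (by linarith), by simp⟩
  have := ENNReal.young_inequality (a ^ (1 - t)) (b ^ t) hp
  rw [← ENNReal.rpow_mul, ← ENNReal.rpow_mul, mul_inv_cancel₀ hs.ne', mul_inv_cancel₀ ht0.ne',
    ENNReal.rpow_one, ENNReal.rpow_one, ENNReal.div_eq_inv_mul, ENNReal.div_eq_inv_mul,
    ENNReal.ofReal_inv_of_pos hs, ENNReal.ofReal_inv_of_pos ht0, inv_inv, inv_inv] at this
  exact this

/-- The Prékopa–Leindler inequality on the line, for bounded functions. -/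
theorem prekopa_leindler_real_of_le {t : ℝ} (ht0 : 0 < t) (ht1 : t < 1) {f g h : ℝ → ℝ≥0∞}
    (hf : Measurable f) (hg : Measurable g) (hh : Measurable h) {N : ℝ≥0∞} (hN : N ≠ ∞)
    (hfN : ∀ x, f x ≤ N) (hgN : ∀ x, g x ≤ N)
    (H : ∀ x y, f x ^ (1 - t) * g y ^ t ≤ h ((1 - t) * x + t * y)) :
    (∫⁻ x, f x) ^ (1 - t) * (∫⁻ x, g x) ^ t ≤ ∫⁻ x, h x := by
  have hs : 0 < 1 - t := by linarith
  set F := ⨆ x, f x with hF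
  set G := ⨆ x, g x with hG
  have hFN : F ≠ ∞ := ne_top_of_le_ne_top hN (iSup_le hfN)
  have hGN : G ≠ ∞ := ne_top_of_le_ne_top hN (iSup_le hgN)
  have hfF : ∀ x, f x ≤ F := le_iSup f
  have hgG : ∀ x, g x ≤ G := le_iSup g
  rcases eq_or_ne F 0 with h0 | hF0
  · have : ∀ x, f x = 0 := fun x => le_antisymm (h0 ▸ hfF x) bot_le
    simp [this, hs]
  rcases eq_or_ne G 0 with h0 | hG0
  · have : ∀ x, g x = 0 := fun x => le_antisymm (h0 ▸ hgG x) bot_le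
    simp [this, ht0]
  set M := F ^ (1 - t) * G ^ t with hM
  have hFr0 : F ^ (1 - t) ≠ 0 := by simp [hF0, hFN]
  have hGr0 : G ^ t ≠ 0 := by simp [hG0, hGN]
  have hFr1 : F ^ (1 - t) ≠ ∞ := by simp [hF0, hFN]
  have hGr1 : G ^ t ≠ ∞ := by simp [hG0, hGN]
  have hM0 : M ≠ 0 := mul_ne_zero hFr0 hGr0
  have hM1 : M ≠ ∞ := ENNReal.mul_ne_top hFr1 hGr1
  have hfle : ∀ x, f x / F ≤ 1 := fun x => ENNReal.div_le_of_le_mul (by simpa using hfF x)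
  have hgle : ∀ x, g x / G ≤ 1 := fun x => ENNReal.div_le_of_le_mul (by simpa using hgG x)
  have sup : ∀ (u : ℝ → ℝ≥0∞), (⨆ x, u x) ≠ 0 → (⨆ x, u x) ≠ ∞ → (∀ x, u x / (⨆ x, u x) ≤ 1) →
      ∀ s < (1 : ℝ), ∃ x, s < (u x / (⨆ x, u x)).toReal := by
    intro u h0 h1 hle s hs1
    have : ENNReal.ofReal s * (⨆ x, u x) < ⨆ x, u x := by
      conv_rhs => rw [← one_mul (⨆ x, u x)]
      exact (ENNReal.mul_lt_mul_iff_left h0 h1).2 (ENNReal.ofReal_lt_one.2 hs1)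
    obtain ⟨x, hx⟩ := lt_iSup_iff.1 this
    refine ⟨x, ?_⟩
    rw [← ENNReal.lt_div_iff_mul_lt (.inl h0) (.inl h1)] at hx
    have hx' := (ENNReal.toReal_lt_toReal ENNReal.ofReal_ne_top
      (ne_top_of_le_ne_top (by simp) (hle x))).2 hx
    refine lt_of_le_of_lt ?_ hx'
    rw [ENNReal.toReal_ofReal']
    exact le_max_left _ _
  -- Truncating `h / M` at 1 keeps it finite, so that `toReal` does not send `∞` to 0. Nothing is
  -- lost, because the geometric mean of `f / F` and `g / G` is at most 1.
  have key := add_lintegral_le_of_sup_one ht0 ht1 (f := fun x => (f x / F).toReal)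
    (g := fun x => (g x / G).toReal) (h := fun x => (min (h x / M) 1).toReal)
    (hf.div_const _).ennreal_toReal (hg.div_const _).ennreal_toReal
    ((hh.div_const _).min measurable_const).ennreal_toReal
    (fun x => ENNReal.toReal_nonneg) (fun x => ENNReal.toReal_nonneg)
    (fun x => ENNReal.toReal_nonneg) (fun x => ENNReal.toReal_mono (by simp) (hfle x))
    (fun x => ENNReal.toReal_mono (by simp) (hgle x)) (sup f hF0 hFN hfle) (sup g hG0 hGN hgle) ?_
  · have r : ∀ u : ℝ≥0∞, u ≤ 1 → ENNReal.ofReal u.toReal = u := fun u hu =>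
      ENNReal.ofReal_toReal (ne_top_of_le_ne_top (by simp) hu)
    simp only [fun x => r _ (hfle x), fun x => r _ (hgle x), fun x => r _ (min_le_right (h x / M) 1)]
      at key
    have k2 := (ennreal_geom_mean_le ht0 ht1 _ _).trans (key.trans
      (lintegral_mono fun x => min_le_left (h x / M) 1))
    simp only [div_eq_mul_inv] at k2
    rw [lintegral_mul_const _ hf, lintegral_mul_const _ hg, lintegral_mul_const _ hh,
      ENNReal.mul_rpow_of_nonneg _ _ hs.le, ENNReal.mul_rpow_of_nonneg _ _ ht0.le,
      mul_mul_mul_comm, ENNReal.inv_rpow, ENNReal.inv_rpow,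
      ← ENNReal.mul_inv (.inl hFr0) (.inl hFr1)] at k2
    exact (ENNReal.mul_le_mul_iff_left (ENNReal.inv_ne_zero.2 hM1) (ENNReal.inv_ne_top.2 hM0)).1 k2
  · intro x y
    rw [ENNReal.toReal_rpow, ENNReal.toReal_rpow, ← ENNReal.toReal_mul]
    refine ENNReal.toReal_mono (ne_top_of_le_ne_top (by simp) (min_le_right _ _)) (le_min ?_ ?_)
    · rw [ENNReal.div_rpow_of_nonneg _ _ hs.le, ENNReal.div_rpow_of_nonneg _ _ ht0.le]
      rw [div_eq_mul_inv, div_eq_mul_inv, div_eq_mul_inv, mul_mul_mul_comm,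
        ← ENNReal.mul_inv (.inl hFr0) (.inl hFr1)]
      gcongr
      exact H x y
    · exact mul_le_one' (ENNReal.rpow_le_one (hfle x) hs.le) (ENNReal.rpow_le_one (hgle y) ht0.le)

theorem lintegral_eq_iSup_min {α : Type*} [MeasurableSpace α] (μ : Measure α) {f : α → ℝ≥0∞}
    (hf : Measurable f) : ∫⁻ x, f x ∂μ = ⨆ N : ℕ, ∫⁻ x, min (f x) N ∂μ := by
  rw [← lintegral_iSup (fun N => hf.min measurable_const)]
  · congr with x
    rw [← inf_iSup_eq, ENNReal.iSup_natCast, inf_top_eq]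
  · intro N M h x
    exact min_le_min_left _ (by exact_mod_cast h)

/-- The Prékopa–Leindler inequality on the line. -/
theorem prekopa_leindler_real {t : ℝ} (ht0 : 0 < t) (ht1 : t < 1) {f g h : ℝ → ℝ≥0∞}
    (hf : Measurable f) (hg : Measurable g) (hh : Measurable h)
    (H : ∀ x y, f x ^ (1 - t) * g y ^ t ≤ h ((1 - t) * x + t * y)) :
    (∫⁻ x, f x) ^ (1 - t) * (∫⁻ x, g x) ^ t ≤ ∫⁻ x, h x := by
  have hs : 0 < 1 - t := by linarith
  have mono : ∀ {u : ℝ → ℝ≥0∞}, Monotone fun N : ℕ => ∫⁻ x, min (u x) N := fun {u} N M h =>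
    lintegral_mono fun x => min_le_min_left _ (by exact_mod_cast h)
  have tend : ∀ {u : ℝ → ℝ≥0∞} {r : ℝ}, Measurable u → 0 < r → Filter.Tendsto
      (fun N : ℕ => (∫⁻ x, min (u x) N) ^ r) Filter.atTop (nhds ((∫⁻ x, u x) ^ r)) := by
    intro u r hu hr
    rw [lintegral_eq_iSup_min _ hu]
    exact (ENNReal.continuous_rpow_const.tendsto _).comp (tendsto_atTop_iSup mono)
  have bdd : ∀ N : ℕ,
      (∫⁻ x, min (f x) N) ^ (1 - t) * (∫⁻ x, min (g x) N) ^ t ≤ ∫⁻ x, h x := fun N =>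
    prekopa_leindler_real_of_le ht0 ht1 (hf.min measurable_const) (hg.min measurable_const) hh
      (ENNReal.natCast_ne_top N) (fun x => min_le_right _ _) (fun x => min_le_right _ _)
      fun x y => le_trans (by gcongr <;> exact min_le_left _ _) (H x y)
  -- Multiplication in `ℝ≥0∞` is discontinuous at `0 * ∞`, so vanishing integrals are treated before
  -- passing to the limit.
  rcases eq_or_ne (∫⁻ x, f x) 0 with h0 | h0
  · simp [h0, hs]
  rcases eq_or_ne (∫⁻ x, g x) 0 with h1 | h1
  · simp [h1, ht0]
  refine le_of_tendsto (ENNReal.Tendsto.mul (tend hf hs) (.inl ?_) (tend hg ht0) (.inl ?_))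
    (.of_forall bdd)
  · simp [h0, hs, ht1.le]
  · simp [h1, ht0, ht0.le]

/-! ### Multiplicative Prékopa–Leindler on the positive orthant -/

/-- The multiplicative form of the Prékopa–Leindler inequality on the half-line. -/
theorem prekopa_leindler_Ioi {t : ℝ} (ht0 : 0 < t) (ht1 : t < 1) {f g h : ℝ → ℝ≥0∞}
    (hf : Measurable f) (hg : Measurable g) (hh : Measurable h)
    (H : ∀ x y, 0 < x → 0 < y → f x ^ (1 - t) * g y ^ t ≤ h (x ^ (1 - t) * y ^ t)) :
    (∫⁻ x in Ioi 0, f x) ^ (1 - t) * (∫⁻ x in Ioi 0, g x) ^ t ≤ ∫⁻ x in Ioi 0, h x := by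
  have hs : 0 < 1 - t := by linarith
  have cv : ∀ u : ℝ → ℝ≥0∞, ∫⁻ x in Ioi 0, u x
      = ∫⁻ s, ENNReal.ofReal (Real.exp s) * u (Real.exp s) := by
    intro u
    have := lintegral_image_eq_lintegral_abs_deriv_mul (f := Real.exp) (f' := Real.exp)
      MeasurableSet.univ (fun x _ => (Real.hasDerivAt_exp x).hasDerivWithinAt)
      Real.exp_injective.injOn u
    rw [image_univ, Real.range_exp] at this
    simpa using this
  have ms : ∀ {u : ℝ → ℝ≥0∞}, Measurable u →
      Measurable fun s => ENNReal.ofReal (Real.exp s) * u (Real.exp s) := fun hu =>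
    Real.measurable_exp.ennreal_ofReal.mul (hu.comp Real.measurable_exp)
  rw [cv f, cv g, cv h]
  refine prekopa_leindler_real ht0 ht1 (ms hf) (ms hg) (ms hh) fun x y => ?_
  -- The Jacobian `exp s` of the substitution is log-affine, so it satisfies the Prékopa–Leindler
  -- hypothesis with equality.
  have e : Real.exp ((1 - t) * x + t * y) = Real.exp x ^ (1 - t) * Real.exp y ^ t := by
    rw [← Real.exp_mul, ← Real.exp_mul, ← Real.exp_add]
    ring_nf
  rw [ENNReal.mul_rpow_of_nonneg _ _ hs.le, ENNReal.mul_rpow_of_nonneg _ _ ht0.le,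
    mul_mul_mul_comm, e, ENNReal.ofReal_mul (by positivity),
    ENNReal.ofReal_rpow_of_pos (Real.exp_pos x), ENNReal.ofReal_rpow_of_pos (Real.exp_pos y)]
  gcongr
  exact H _ _ (Real.exp_pos x) (Real.exp_pos y)

/-- The open positive orthant. -/
def posOrthant (n : ℕ) : Set (Fin n → ℝ) := Set.pi univ fun _ => Ioi 0

theorem mem_posOrthant {n : ℕ} {x : Fin n → ℝ} : x ∈ posOrthant n ↔ ∀ i, 0 < x i := by
  simp [posOrthant]

theorem measurableSet_posOrthant (n : ℕ) : MeasurableSet (posOrthant n) :=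
  MeasurableSet.univ_pi fun _ => measurableSet_Ioi

theorem measurable_fin_cons {n : ℕ} :
    Measurable fun p : ℝ × (Fin n → ℝ) => (Fin.cons p.1 p.2 : Fin (n + 1) → ℝ) := by
  refine measurable_pi_lambda _ fun i => ?_
  refine Fin.cases ?_ (fun j => ?_) i
  · simpa using measurable_fst
  · exact (measurable_pi_apply j).comp measurable_snd

theorem setLIntegral_posOrthant_succ {n : ℕ} {f : (Fin (n + 1) → ℝ) → ℝ≥0∞} (hf : Measurable f) :
    ∫⁻ x in posOrthant (n + 1), f x
      = ∫⁻ a in Ioi 0, ∫⁻ x in posOrthant n, f (Fin.cons a x) := by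
  have mp := (volume_preserving_piFinSuccAbove (fun _ : Fin (n + 1) => ℝ) 0).symm
  rw [← mp.setLIntegral_comp_preimage (measurableSet_posOrthant _) hf]
  have e : ∀ p : ℝ × (Fin n → ℝ),
      (MeasurableEquiv.piFinSuccAbove (fun _ : Fin (n + 1) => ℝ) 0).symm p = Fin.cons p.1 p.2 := by
    intro p
    simp [MeasurableEquiv.piFinSuccAbove]
    rfl
  have pre : (MeasurableEquiv.piFinSuccAbove (fun _ : Fin (n + 1) => ℝ) 0).symm ⁻¹'
      posOrthant (n + 1) = Ioi 0 ×ˢ posOrthant n := by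
    ext p
    simp [mem_posOrthant, Fin.forall_fin_succ]
  rw [pre, Measure.volume_eq_prod, ← Measure.prod_restrict]
  simp only [e]
  exact lintegral_prod _ (hf.comp measurable_fin_cons).aemeasurable

/-- The multiplicative form of the Prékopa–Leindler inequality on the positive orthant. -/
theorem prekopa_leindler_posOrthant {t : ℝ} (ht0 : 0 < t) (ht1 : t < 1) {n : ℕ}
    {f g h : (Fin n → ℝ) → ℝ≥0∞} (hf : Measurable f) (hg : Measurable g) (hh : Measurable h)
    (H : ∀ x ∈ posOrthant n, ∀ y ∈ posOrthant n,
      f x ^ (1 - t) * g y ^ t ≤ h fun i => x i ^ (1 - t) * y i ^ t) :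
    (∫⁻ x in posOrthant n, f x) ^ (1 - t) * (∫⁻ x in posOrthant n, g x) ^ t
      ≤ ∫⁻ x in posOrthant n, h x := by
  induction n with
  | zero =>
    have e : ∀ u : (Fin 0 → ℝ) → ℝ≥0∞, ∫⁻ x in posOrthant 0, u x = u default := by
      intro u
      have : posOrthant 0 = univ := by ext; simp [mem_posOrthant]
      rw [this, Measure.restrict_univ, volume_pi, Measure.pi_of_empty _ default,
        lintegral_dirac]
    rw [e, e, e]
    refine (H default (by simp [mem_posOrthant]) default (by simp [mem_posOrthant])).trans_eq ?_
    congr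
    ext i
    exact i.elim0
  | succ n ih =>
    rw [setLIntegral_posOrthant_succ hf, setLIntegral_posOrthant_succ hg,
      setLIntegral_posOrthant_succ hh]
    have ms : ∀ {u : (Fin (n + 1) → ℝ) → ℝ≥0∞}, Measurable u →
        Measurable fun a => ∫⁻ x in posOrthant n, u (Fin.cons a x) := fun hu =>
      Measurable.lintegral_prod_right (hu.comp measurable_fin_cons)
    refine prekopa_leindler_Ioi ht0 ht1 (ms hf) (ms hg) (ms hh) fun a b ha hb => ?_
    have mc : ∀ c : ℝ, Measurable fun x : Fin n → ℝ => (Fin.cons c x : Fin (n + 1) → ℝ) :=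
      fun c => measurable_fin_cons.comp (measurable_const.prodMk measurable_id)
    refine ih (hf.comp (mc a)) (hg.comp (mc b)) (hh.comp (mc _)) fun x hx y hy => ?_
    rw [mem_posOrthant] at hx hy
    refine (H (Fin.cons a x) ?_ (Fin.cons b y) ?_).trans_eq ?_
    · simp [mem_posOrthant, Fin.forall_fin_succ, ha, hx]
    · simp [mem_posOrthant, Fin.forall_fin_succ, hb, hy]
    · congr 1
      ext i
      refine Fin.cases ?_ (fun j => ?_) i <;> simp

/-! ### Linearization and rigidity in the equality case -/

/-- A Prékopa–Leindler inequality between probability measures, applied to `exp (δ u)`,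
`exp (δ v)`, `exp (δ w)` as `δ → 0`. -/
theorem add_integral_le_of_prekopa_leindler {Ω : Type*} [MeasurableSpace Ω] {μ ν γ : Measure Ω}
    [IsProbabilityMeasure μ] [IsProbabilityMeasure ν] [IsProbabilityMeasure γ] {A B C : Set Ω}
    {m : Ω → Ω → Ω} {t : ℝ} (ht0 : 0 < t) (ht1 : t < 1)
    (hA : ∀ᵐ x ∂μ, x ∈ A) (hB : ∀ᵐ x ∂ν, x ∈ B) (hC : ∀ᵐ x ∂γ, x ∈ C)
    (PL : ∀ u v w : Ω → ℝ≥0∞, Measurable u → Measurable v → Measurable w →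
      (∀ x ∈ A, ∀ y ∈ B, u x ^ (1 - t) * v y ^ t ≤ w (m x y)) →
      (∫⁻ x, u x ∂μ) ^ (1 - t) * (∫⁻ x, v x ∂ν) ^ t ≤ ∫⁻ x, w x ∂γ)
    {u v w : Ω → ℝ} (hu : Measurable u) (hv : Measurable v) (hw : Measurable w) {M : ℝ}
    (huM : ∀ x ∈ A, |u x| ≤ M) (hvM : ∀ x ∈ B, |v x| ≤ M) (hwM : ∀ x ∈ C, |w x| ≤ M)
    (H : ∀ x ∈ A, ∀ y ∈ B, (1 - t) * u x + t * v y ≤ w (m x y)) :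
    (1 - t) * ∫ x, u x ∂μ + t * ∫ x, v x ∂ν ≤ ∫ x, w x ∂γ := by
  have hs : 0 < 1 - t := by linarith
  have hMM : 0 ≤ M := by
    obtain ⟨x, hx⟩ := hA.exists
    exact (abs_nonneg _).trans (huM x hx)
  have int : ∀ {ρ : Measure Ω} [IsProbabilityMeasure ρ] {S : Set Ω} {a : Ω → ℝ},
      (∀ᵐ x ∂ρ, x ∈ S) → Measurable a → (∀ x ∈ S, |a x| ≤ M) →
      Integrable a ρ ∧ ∀ δ : ℝ, 0 ≤ δ → Integrable (fun x => Real.exp (δ * a x)) ρ := by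
    intro ρ _ S a hS ha hb
    refine ⟨.of_bound ha.aestronglyMeasurable M (hS.mono fun x hx => hb x hx), fun δ hδ => ?_⟩
    refine .of_bound (ha.const_mul δ).exp.aestronglyMeasurable (Real.exp (δ * M))
      (hS.mono fun x hx => ?_)
    rw [Real.norm_eq_abs, Real.abs_exp, Real.exp_le_exp]
    exact mul_le_mul_of_nonneg_left ((le_abs_self _).trans (hb x hx)) hδ
  have low : ∀ {ρ : Measure Ω} [IsProbabilityMeasure ρ] {S : Set Ω} {a : Ω → ℝ},
      (∀ᵐ x ∂ρ, x ∈ S) → Measurable a → (∀ x ∈ S, |a x| ≤ M) → ∀ δ : ℝ, 0 ≤ δ →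
      ENNReal.ofReal (Real.exp (δ * ∫ x, a x ∂ρ))
        ≤ ∫⁻ x, ENNReal.ofReal (Real.exp (δ * a x)) ∂ρ := by
    intro ρ _ S a hS ha hb δ hδ
    obtain ⟨h1, h2⟩ := int hS ha hb
    rw [← ofReal_integral_eq_lintegral_ofReal (h2 δ hδ) (.of_forall fun x => (Real.exp_pos _).le),
      ← integral_const_mul]
    exact ENNReal.ofReal_le_ofReal (convexOn_exp.map_integral_le Real.continuous_exp.continuousOn
      isClosed_univ (.of_forall fun _ => mem_univ _) (h1.const_mul δ) (h2 δ hδ))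
  have me : ∀ {a : Ω → ℝ} (δ : ℝ), Measurable a →
      Measurable fun x => ENNReal.ofReal (Real.exp (δ * a x)) := fun δ ha =>
    (ha.const_mul δ).exp.ennreal_ofReal
  obtain ⟨iw, iw'⟩ := int hC hw hwM
  set S := (1 - t) * ∫ x, u x ∂μ + t * ∫ x, v x ∂ν
  -- Jensen bounds the left side below by `exp (δ S) ≥ 1 + δ S`, while `exp (δ w) ≤ 1 + δ w + (δ M)
  -- ^ 2` bounds the right side above; the ones cancel and `δ` is divided out.
  have step : ∀ δ : ℝ, 0 < δ → δ * M ≤ 1 → S ≤ ∫ x, w x ∂γ + δ * M ^ 2 := by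
    intro δ hδ hδM
    have e : ∀ a b : ℝ, ENNReal.ofReal (Real.exp (δ * a)) ^ (1 - t)
        * ENNReal.ofReal (Real.exp (δ * b)) ^ t
        = ENNReal.ofReal (Real.exp (δ * ((1 - t) * a + t * b))) := by
      intro a b
      rw [ENNReal.ofReal_rpow_of_pos (Real.exp_pos _), ENNReal.ofReal_rpow_of_pos (Real.exp_pos _),
        ← ENNReal.ofReal_mul (by positivity), ← Real.exp_mul, ← Real.exp_mul, ← Real.exp_add]
      ring_nf
    have h1 := PL _ _ _ (me δ hu) (me δ hv) (me δ hw) fun x hx y hy => by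
      rw [e]
      exact ENNReal.ofReal_le_ofReal
        (Real.exp_le_exp.2 (mul_le_mul_of_nonneg_left (H x hx y hy) hδ.le))
    have h2 : ENNReal.ofReal (Real.exp (δ * S)) ≤ ENNReal.ofReal (∫ x, Real.exp (δ * w x) ∂γ) := by
      rw [ofReal_integral_eq_lintegral_ofReal (iw' δ hδ.le)
        (.of_forall fun x => (Real.exp_pos _).le)]
      refine le_trans ?_ h1
      rw [← e]
      gcongr
      · exact low hA hu huM δ hδ.le
      · exact low hB hv hvM δ hδ.le
    have h3 := (ENNReal.ofReal_le_ofReal_iff (integral_nonneg fun x => (Real.exp_pos _).le)).1 h2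
    have h4 : ∫ x, Real.exp (δ * w x) ∂γ ≤ ∫ x, (1 + δ * w x + (δ * M) ^ 2) ∂γ := by
      refine integral_mono_ae (iw' δ hδ.le)
        (((integrable_const _).add (iw.const_mul δ)).add (integrable_const _))
        (hC.mono fun x hx => ?_)
      have hb : |δ * w x| ≤ δ * M := by
        rw [abs_mul, abs_of_pos hδ]
        exact mul_le_mul_of_nonneg_left (hwM x hx) hδ.le
      have h5 := (abs_le.1 (Real.abs_exp_sub_one_sub_id_le (hb.trans hδM))).2
      have h6 : (δ * w x) ^ 2 ≤ (δ * M) ^ 2 := sq_le_sq' (by linarith [abs_le.1 hb]) (abs_le.1 hb).2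
      simp only
      linarith
    rw [integral_add (f := fun x => 1 + δ * w x) ((integrable_const _).add (iw.const_mul δ))
      (integrable_const _), integral_add (integrable_const _) (iw.const_mul δ), integral_const_mul] at h4
    simp only [integral_const, probReal_univ, smul_eq_mul, one_mul] at h4
    have h7 := Real.add_one_le_exp (δ * S)
    have h8 : δ * S ≤ δ * (∫ x, w x ∂γ + δ * M ^ 2) := by linarith
    exact le_of_mul_le_mul_left h8 hδ
  by_contra! hlt
  set D := S - ∫ x, w x ∂γ
  have hD : 0 < D := sub_pos.2 hlt
  -- The first entry ensures `δ * M ≤ 1`; the second makes the error `δ * M ^ 2` at most `D / 2`,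
  -- contradicting a gap of `D`.
  have h1 := step (min (1 / (M + 1)) (D / (2 * (M ^ 2 + 1)))) (by positivity) <| by
    calc _ ≤ 1 / (M + 1) * M := mul_le_mul_of_nonneg_right (min_le_left _ _) hMM
      _ ≤ 1 := by
        rw [div_mul_eq_mul_div, div_le_one (by positivity)]
        linarith
  have h2 : min (1 / (M + 1)) (D / (2 * (M ^ 2 + 1))) * M ^ 2 ≤ D / 2 := by
    calc _ ≤ D / (2 * (M ^ 2 + 1)) * M ^ 2 :=
          mul_le_mul_of_nonneg_right (min_le_right _ _) (sq_nonneg _)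
      _ ≤ D / 2 := by
        rw [div_mul_eq_mul_div, div_le_div_iff₀ (by positivity) (by positivity)]
        nlinarith
  simp only [D] at h2 hD
  linarith

/-- A quantitative form of the weighted inequality of arithmetic and geometric means. -/
theorem min_mul_sq_sqrt_sub_le {t : ℝ} (ht0 : 0 < t) (ht1 : t < 1) {x y : ℝ} (hx : 0 ≤ x)
    (hy : 0 ≤ y) :
    min t (1 - t) * (√x - √y) ^ 2 ≤ (1 - t) * x + t * y - x ^ (1 - t) * y ^ t := by
  have key : ∀ {t : ℝ}, 0 < t → t ≤ 1 / 2 → ∀ {x y : ℝ}, 0 ≤ x → 0 ≤ y →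
      t * (√x - √y) ^ 2 ≤ (1 - t) * x + t * y - x ^ (1 - t) * y ^ t := by
    intro t ht0 ht2 x y hx hy
    -- AM–GM for `x` and `√x * √y`: the arithmetic side `(1 - 2 t) x + 2 t √x √y` is `(1 - t) x + t
    -- y - t (√x - √y) ^ 2`, which is why `t ≤ 1 / 2` is treated first.
    have h := Real.geom_mean_le_arith_mean2_weighted (w₁ := 1 - 2 * t) (w₂ := 2 * t)
      (by linarith) (by linarith) hx (mul_nonneg (Real.sqrt_nonneg x) (Real.sqrt_nonneg y))
      (by ring)
    have e : x ^ (1 - 2 * t) * (√x * √y) ^ (2 * t) = x ^ (1 - t) * y ^ t := by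
      rw [Real.mul_rpow (Real.sqrt_nonneg x) (Real.sqrt_nonneg y), Real.rpow_mul
        (Real.sqrt_nonneg x), Real.rpow_mul (Real.sqrt_nonneg y), Real.rpow_two, Real.rpow_two,
        Real.sq_sqrt hx, Real.sq_sqrt hy, ← mul_assoc, ← Real.rpow_add_of_nonneg hx]
      · ring_nf
      · linarith
      · linarith
    rw [e] at h
    nlinarith [Real.sq_sqrt hx, Real.sq_sqrt hy]
  rcases le_total t (1 / 2) with h | h
  · rw [min_eq_left (by linarith)]
    exact key ht0 h hx hy
  · rw [min_eq_right (by linarith)]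
    have := key (t := 1 - t) (by linarith) (by linarith) hy hx
    rw [sub_sub_cancel] at this
    linarith [mul_comm (x ^ (1 - t)) (y ^ t), show (√y - √x) ^ 2 = (√x - √y) ^ 2 by ring]

/-- The difference `x - y` factors as `(√x - √y) (√x + √y)`, and the square of the second factor is
at most `4 R`. -/
theorem sq_sub_le_of_le {t : ℝ} (ht0 : 0 < t) (ht1 : t < 1) {x y R : ℝ} (hx : 0 ≤ x)
    (hy : 0 ≤ y) (hR : 0 < R) (hxR : x ≤ R) (hyR : y ≤ R) :
    min t (1 - t) / (4 * R) * (x - y) ^ 2 ≤ (1 - t) * x + t * y - x ^ (1 - t) * y ^ t := by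
  refine le_trans ?_ (min_mul_sq_sqrt_sub_le ht0 ht1 hx hy)
  have hm : 0 < min t (1 - t) := lt_min ht0 (by linarith)
  have h1 : √x ≤ √R := Real.sqrt_le_sqrt hxR
  have h2 : √y ≤ √R := Real.sqrt_le_sqrt hyR
  have h3 : (√x + √y) ^ 2 ≤ 4 * R := by
    nlinarith [Real.sqrt_nonneg x, Real.sqrt_nonneg y, Real.sq_sqrt hR.le]
  have h4 : (x - y) ^ 2 = (√x - √y) ^ 2 * (√x + √y) ^ 2 := by
    rw [← mul_pow]
    congr 1
    nlinarith [Real.sq_sqrt hx, Real.sq_sqrt hy]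
  rw [div_mul_eq_mul_div, div_le_iff₀ (by positivity), h4, mul_assoc]
  gcongr

/-- The coordinatewise weighted geometric mean. -/
noncomputable def geomMean {n : ℕ} (t : ℝ) (x y : Fin n → ℝ) : Fin n → ℝ :=
  fun i => x i ^ (1 - t) * y i ^ t

/-- The uniform probability measure on a set. -/
noncomputable def unif {n : ℕ} (A : Set (Fin n → ℝ)) : Measure (Fin n → ℝ) :=
  (volume A)⁻¹ • volume.restrict A

theorem isProbabilityMeasure_unif {n : ℕ} {A : Set (Fin n → ℝ)} (h0 : volume A ≠ 0)
    (h1 : volume A ≠ ∞) : IsProbabilityMeasure (unif A) :=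
  ⟨by simp [unif, ENNReal.inv_mul_cancel h0 h1]⟩

theorem ae_unif_mem {n : ℕ} {A : Set (Fin n → ℝ)} (hA : MeasurableSet A) :
    ∀ᵐ x ∂unif A, x ∈ A :=
  Measure.ae_smul_measure (ae_restrict_mem hA) _

/-- The orthant inequality is applied to indicator multiples and divided by the volumes. The bound
`hv`, opposite to Prékopa–Leindler, is what makes the normalizing factors work in the right
direction. -/
theorem prekopa_leindler_unif {n : ℕ} {t : ℝ} (ht0 : 0 < t) (ht1 : t < 1)
    {A B C : Set (Fin n → ℝ)} (hA : MeasurableSet A) (hB : MeasurableSet B) (hC : MeasurableSet C)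
    (hAp : A ⊆ posOrthant n) (hBp : B ⊆ posOrthant n) (hCp : C ⊆ posOrthant n)
    (hA0 : volume A ≠ 0) (hA1 : volume A ≠ ∞)
    (hABC : ∀ x ∈ A, ∀ y ∈ B, geomMean t x y ∈ C)
    (hv : volume C ≤ volume A ^ (1 - t) * volume B ^ t) (u v w : (Fin n → ℝ) → ℝ≥0∞)
    (hu : Measurable u) (hv' : Measurable v) (hw : Measurable w)
    (H : ∀ x ∈ A, ∀ y ∈ B, u x ^ (1 - t) * v y ^ t ≤ w (geomMean t x y)) :
    (∫⁻ x, u x ∂unif A) ^ (1 - t) * (∫⁻ x, v x ∂unif B) ^ t ≤ ∫⁻ x, w x ∂unif C := by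
  have hs : 0 < 1 - t := by linarith
  have e : ∀ {S : Set (Fin n → ℝ)} (a : (Fin n → ℝ) → ℝ≥0∞), MeasurableSet S →
      S ⊆ posOrthant n → ∫⁻ x in posOrthant n, S.indicator a x = ∫⁻ x in S, a x := by
    intro S a hS hSp
    rw [lintegral_indicator hS, Measure.restrict_restrict hS, inter_eq_left.2 hSp]
  have key := prekopa_leindler_posOrthant ht0 ht1 (hu.indicator hA) (hv'.indicator hB)
    (hw.indicator hC) fun x _ y _ => by
      change _ ≤ C.indicator w (geomMean t x y)
      by_cases hx : x ∈ A
      · by_cases hy : y ∈ B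
        · rw [indicator_of_mem hx, indicator_of_mem hy,
            indicator_of_mem (hABC x hx y hy)]
          exact H x hx y hy
        · simp [hy, ht0]
      · simp [hx, hs]
  rw [e u hA hAp, e v hB hBp, e w hC hCp] at key
  simp only [unif, lintegral_smul_measure, smul_eq_mul]
  rw [ENNReal.mul_rpow_of_nonneg _ _ hs.le, ENNReal.mul_rpow_of_nonneg _ _ ht0.le,
    mul_mul_mul_comm, ENNReal.inv_rpow, ENNReal.inv_rpow, ← ENNReal.mul_inv]
  · gcongr
  · left; simp [hA0, hA1]
  · left; simp [hA0, hA1]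

theorem integrable_apply_unif {n : ℕ} {A : Set (Fin n → ℝ)} (hA : MeasurableSet A)
    (hA0 : volume A ≠ 0) (hA1 : volume A ≠ ∞) {R : ℝ} (hAR : A ⊆ Icc 0 fun _ => R) (i : Fin n) :
    Integrable (fun x : Fin n → ℝ => x i) (unif A) := by
  have := isProbabilityMeasure_unif hA0 hA1
  refine .of_bound (measurable_pi_apply i).aestronglyMeasurable R
    ((ae_unif_mem hA).mono fun x hx => ?_)
  rw [Real.norm_eq_abs, abs_of_nonneg ((hAR hx).1 i)]
  exact (hAR hx).2 i

theorem integral_apply_unif_pos {n : ℕ} {A : Set (Fin n → ℝ)} (hA : MeasurableSet A)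
    (hA0 : volume A ≠ 0) (hA1 : volume A ≠ ∞) (hAp : A ⊆ posOrthant n) {R : ℝ}
    (hAR : A ⊆ Icc 0 fun _ => R) (i : Fin n) : 0 < ∫ x, x i ∂unif A := by
  have := isProbabilityMeasure_unif hA0 hA1
  have hp : ∀ᵐ x ∂unif A, 0 < x i := (ae_unif_mem hA).mono fun x hx => mem_posOrthant.1 (hAp hx) i
  refine lt_of_le_of_ne (integral_nonneg_of_ae (hp.mono fun x hx => hx.le)) fun h => ?_
  have h0 := (integral_eq_zero_iff_of_nonneg_ae (hp.mono fun x hx => hx.le)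
    (integrable_apply_unif hA hA0 hA1 hAR i)).1 h.symm
  obtain ⟨x, hx, hx'⟩ := (hp.and h0).exists
  exact hx.ne' hx'

theorem geom_mean_ne_zero_ne_top {t : ℝ} {a b : ℝ≥0∞} (ha0 : a ≠ 0) (ha1 : a ≠ ∞) (hb0 : b ≠ 0) (hb1 : b ≠ ∞) :
    a ^ (1 - t) * b ^ t ≠ 0 ∧ a ^ (1 - t) * b ^ t ≠ ∞ :=
  ⟨mul_ne_zero (by simp [ha0, ha1]) (by simp [hb0, hb1]),
    ENNReal.mul_ne_top (by simp [ha0, ha1]) (by simp [hb0, hb1])⟩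

/-- In the equality case of the multiplicative Prékopa–Leindler inequality, the set `B`, scaled by
its barycenter, is contained in every closed set that contains `A`, scaled by its barycenter. -/
theorem ae_mem_of_volume_eq {n : ℕ} {t : ℝ} (ht0 : 0 < t) (ht1 : t < 1)
    {A B C : Set (Fin n → ℝ)} (hA : MeasurableSet A) (hB : MeasurableSet B) (hC : MeasurableSet C)
    (hAp : A ⊆ posOrthant n) (hBp : B ⊆ posOrthant n) (hCp : C ⊆ posOrthant n)
    (hA0 : volume A ≠ 0) (hA1 : volume A ≠ ∞) (hB0 : volume B ≠ 0) (hB1 : volume B ≠ ∞)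
    {R : ℝ} (hAR : A ⊆ Icc 0 fun _ => R) (hBR : B ⊆ Icc 0 fun _ => R) (hCR : C ⊆ Icc 0 fun _ => R)
    (hABC : ∀ x ∈ A, ∀ y ∈ B, geomMean t x y ∈ C)
    (hv : volume C = volume A ^ (1 - t) * volume B ^ t) {S : Set (Fin n → ℝ)} (hS : IsClosed S)
    (hAS : ∀ x ∈ A, (fun i => x i / ∫ x, x i ∂unif A) ∈ S) :
    ∀ᵐ y ∂unif B, (fun i => y i / ∫ x, x i ∂unif B) ∈ S := by
  have hs : 0 < 1 - t := by linarith
  obtain ⟨hC0, hC1⟩ := geom_mean_ne_zero_ne_top hA0 hA1 hB0 hB1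
  rw [← hv] at hC0 hC1
  have := isProbabilityMeasure_unif hA0 hA1
  have := isProbabilityMeasure_unif hB0 hB1
  have := isProbabilityMeasure_unif hC0 hC1
  have PL := prekopa_leindler_unif ht0 ht1 hA hB hC hAp hBp hCp hA0 hA1 hABC hv.le
  set α : Fin n → ℝ := fun i => ∫ x, x i ∂unif A with hα
  set β : Fin n → ℝ := fun i => ∫ x, x i ∂unif B with hβ
  have hα0 : ∀ i, 0 < α i := integral_apply_unif_pos hA hA0 hA1 hAp hAR
  have hβ0 : ∀ i, 0 < β i := integral_apply_unif_pos hB hB0 hB1 hBp hBR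
  have iA := integrable_apply_unif hA hA0 hA1 hAR
  have iB := integrable_apply_unif hB hB0 hB1 hBR
  have iC := integrable_apply_unif hC hC0 hC1 hCR
  have pos : ∀ {T : Set (Fin n → ℝ)}, T ⊆ posOrthant n → ∀ {x}, x ∈ T → ∀ i, 0 < x i := by
    intro T hT x hx
    exact mem_posOrthant.1 (hT hx)
  set ζ : Fin n → ℝ := fun i => α i ^ (1 - t) * β i ^ t with hζ
  have hζ0 : ∀ i, 0 < ζ i := fun i =>
    mul_pos (Real.rpow_pos_of_pos (hα0 i) _) (Real.rpow_pos_of_pos (hβ0 i) _)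
  -- Prékopa–Leindler with the `i`-th coordinate as all three test functions compares the
  -- barycenters.
  have hγ : ∀ i, ζ i ≤ ∫ z, z i ∂unif C := by
    intro i
    have mi : Measurable fun x : Fin n → ℝ => ENNReal.ofReal (x i) :=
      (measurable_pi_apply i).ennreal_ofReal
    have h := PL _ _ _ mi mi mi fun x hx y hy => by
      have hx' := pos hAp hx i
      have hy' := pos hBp hy i
      rw [ENNReal.ofReal_rpow_of_pos hx', ENNReal.ofReal_rpow_of_pos hy',
        ← ENNReal.ofReal_mul (by positivity)]
      rfl
    have ci : ∀ {T : Set (Fin n → ℝ)}, MeasurableSet T → T ⊆ posOrthant n →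
        Integrable (fun x : Fin n → ℝ => x i) (unif T) →
        ∫⁻ x, ENNReal.ofReal (x i) ∂unif T = ENNReal.ofReal (∫ x, x i ∂unif T) := fun hT hTp hi =>
      (ofReal_integral_eq_lintegral_ofReal hi
        ((ae_unif_mem hT).mono fun x hx => (pos hTp hx i).le)).symm
    rw [ci hA hAp (iA i), ci hB hBp (iB i), ci hC hCp (iC i),
      ENNReal.ofReal_rpow_of_pos (hα0 i), ENNReal.ofReal_rpow_of_pos (hβ0 i),
      ← ENNReal.ofReal_mul (Real.rpow_pos_of_pos (hα0 i) _).le, ENNReal.ofReal_le_ofReal_iff'] at h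
    rcases h with h | h
    · exact h
    · exact absurd h (not_le.2 (hζ0 i))
  -- a common bound for the normalized coordinates
  obtain ⟨R', hR', hAR', hBR'⟩ : ∃ R' : ℝ, 0 < R' ∧ (∀ x ∈ A, ∀ i, x i / α i ≤ R') ∧
      ∀ y ∈ B, ∀ i, y i / β i ≤ R' := by
    refine ⟨1 + ∑ j, (|R| / α j + |R| / β j), ?_, ?_, ?_⟩
    · have : 0 ≤ ∑ j, (|R| / α j + |R| / β j) := Finset.sum_nonneg fun j _ =>
        add_nonneg (div_nonneg (abs_nonneg _) (hα0 j).le) (div_nonneg (abs_nonneg _) (hβ0 j).le)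
      linarith
    all_goals
      intro x hx i
      have h2 := Finset.single_le_sum (f := fun j => |R| / α j + |R| / β j) (fun j _ =>
        add_nonneg (div_nonneg (abs_nonneg _) (hα0 j).le) (div_nonneg (abs_nonneg _) (hβ0 j).le))
        (Finset.mem_univ i)
      have h3 := div_nonneg (abs_nonneg R) (hα0 i).le
      have h4 := div_nonneg (abs_nonneg R) (hβ0 i).le
    · have h1 : x i / α i ≤ |R| / α i :=
        div_le_div_of_nonneg_right (((hAR hx).2 i).trans (le_abs_self R)) (hα0 i).le
      linarith
    · have h1 : x i / β i ≤ |R| / β i :=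
        div_le_div_of_nonneg_right (((hBR hx).2 i).trans (le_abs_self R)) (hβ0 i).le
      linarith
  set c : ℝ := min t (1 - t) / (4 * R') with hc
  have hc0 : 0 < c := div_pos (lt_min ht0 hs) (by positivity)
  set φ : (Fin n → ℝ) → ℝ := fun y => Metric.infDist (fun i => y i / β i) S with hφ
  have cφ : Continuous φ := (Metric.continuous_infDist_pt S).comp
    (continuous_pi fun i => (continuous_apply i).div_const _)
  set u : (Fin n → ℝ) → ℝ := fun x => -∑ i, x i / α i with hu
  -- Without the last term, `u`, `v`, `w` satisfy the linearized hypothesis by AM–GM. The factor `c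
  -- / t` makes the added term contribute `c * φ y ^ 2` after weighting by `t`.
  set v : (Fin n → ℝ) → ℝ := fun y => -∑ i, y i / β i + c / t * φ y ^ 2 with hv'
  set w : (Fin n → ℝ) → ℝ := fun z => -∑ i, z i / ζ i with hw
  have cu : Continuous u := by fun_prop
  have cv : Continuous v := by fun_prop
  have cw : Continuous w := by fun_prop
  have bd : ∀ {a : (Fin n → ℝ) → ℝ}, Continuous a →
      ∃ M, ∀ x ∈ Icc (0 : Fin n → ℝ) (fun _ => R), |a x| ≤ M := fun ha =>
    isCompact_Icc.exists_bound_of_continuousOn ha.continuousOn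
  obtain ⟨Mu, hMu⟩ := bd cu
  obtain ⟨Mv, hMv⟩ := bd cv
  obtain ⟨Mw, hMw⟩ := bd cw
  have deficit : ∀ x ∈ A, ∀ y ∈ B, (1 - t) * u x + t * v y ≤ w (geomMean t x y) := by
    intro x hx y hy
    have hX : ∀ i, 0 ≤ x i / α i := fun i => div_nonneg (pos hAp hx i).le (hα0 i).le
    have hY : ∀ i, 0 ≤ y i / β i := fun i => div_nonneg (pos hBp hy i).le (hβ0 i).le
    have hd : ∀ i, c * (x i / α i - y i / β i) ^ 2
        ≤ (1 - t) * (x i / α i) + t * (y i / β i) - geomMean t x y i / ζ i := by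
      intro i
      have h := sq_sub_le_of_le ht0 ht1 (hX i) (hY i) hR' (hAR' x hx i) (hBR' y hy i)
      rwa [Real.div_rpow (pos hAp hx i).le (hα0 i).le, Real.div_rpow (pos hBp hy i).le (hβ0 i).le,
        div_mul_div_comm] at h
    set D := ∑ i, ((1 - t) * (x i / α i) + t * (y i / β i) - geomMean t x y i / ζ i) with hD
    have hd0 : ∀ i, 0 ≤ (1 - t) * (x i / α i) + t * (y i / β i) - geomMean t x y i / ζ i :=
      fun i => (mul_nonneg hc0.le (sq_nonneg _)).trans (hd i)
    -- Since `x / α` lies in `S`, the distance `φ y` is at most the largest `|x i / α i - y i / β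
    -- i|` (sup metric), and a single coordinate's AM–GM deficit is at most the total `D`.
    have hφD : c * φ y ^ 2 ≤ D := by
      have h1 : φ y ≤ √(D / c) := by
        refine (Metric.infDist_le_dist_of_mem (hAS x hx)).trans
          ((dist_pi_le_iff (Real.sqrt_nonneg _)).2 fun i => ?_)
        rw [dist_comm, Real.dist_eq]
        refine Real.abs_le_sqrt ?_
        rw [le_div_iff₀ hc0, mul_comm]
        exact (hd i).trans (Finset.single_le_sum (f := fun i =>
          (1 - t) * (x i / α i) + t * (y i / β i) - geomMean t x y i / ζ i)
          (fun i _ => hd0 i) (Finset.mem_univ i))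
      have h2 : φ y ^ 2 ≤ D / c := by
        rw [← Real.sq_sqrt (div_nonneg (Finset.sum_nonneg fun i _ => hd0 i) hc0.le)]
        exact pow_le_pow_left₀ Metric.infDist_nonneg h1 2
      rwa [le_div_iff₀ hc0, mul_comm] at h2
    have hD' : D = (1 - t) * ∑ i, x i / α i + t * ∑ i, y i / β i
        - ∑ i, geomMean t x y i / ζ i := by
      rw [hD, Finset.sum_sub_distrib, Finset.sum_add_distrib, Finset.mul_sum, Finset.mul_sum]
    have h3 : t * (c / t * φ y ^ 2) = c * φ y ^ 2 := by field_simp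
    simp only [hu, hv', hw, mul_add, h3]
    linarith
  have main := add_integral_le_of_prekopa_leindler ht0 ht1 (ae_unif_mem hA) (ae_unif_mem hB)
    (ae_unif_mem hC) PL cu.measurable cv.measurable cw.measurable (M := max Mu (max Mv Mw))
    (fun x hx => (hMu x (hAR hx)).trans (le_max_left _ _))
    (fun x hx => (hMv x (hBR hx)).trans ((le_max_left _ _).trans (le_max_right _ _)))
    (fun x hx => (hMw x (hCR hx)).trans ((le_max_right _ _).trans (le_max_right _ _))) deficit
  have iφ : Integrable (fun y => φ y ^ 2) (unif B) := by
    obtain ⟨Mp, hMp⟩ := bd (cφ.pow 2)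
    exact .of_bound (cφ.pow 2).aestronglyMeasurable Mp
      ((ae_unif_mem hB).mono fun x hx => hMp x (hBR hx))
  have eu : ∫ x, u x ∂unif A = -n := by
    simp only [hu]
    rw [integral_neg, integral_finsetSum _ fun i _ => (iA i).div_const _]
    simp only [integral_div]
    simp [fun i => div_self (hα0 i).ne', show ∀ i, ∫ x, x i ∂unif A = α i from fun i => rfl]
  have ev : ∫ x, v x ∂unif B = -n + c / t * ∫ y, φ y ^ 2 ∂unif B := by
    simp only [hv']
    rw [integral_add (f := fun y => -∑ i, y i / β i) (integrable_finsetSum _ fun i _ => (iB i).div_const _).neg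
      (iφ.const_mul _), integral_neg, integral_finsetSum _ fun i _ => (iB i).div_const _,
      integral_const_mul]
    simp only [integral_div]
    simp [fun i => div_self (hβ0 i).ne', show ∀ i, ∫ x, x i ∂unif B = β i from fun i => rfl]
  have ew : ∫ x, w x ∂unif C ≤ -n := by
    simp only [hw]
    rw [integral_neg, integral_finsetSum _ fun i _ => (iC i).div_const _]
    simp only [integral_div]
    rw [neg_le_neg_iff]
    calc (n : ℝ) = ∑ i : Fin n, 1 := by simp
      _ ≤ _ := Finset.sum_le_sum fun i _ => (one_le_div (hζ0 i)).2 (hγ i)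
  rw [eu, ev] at main
  have h5 : t * (c / t * ∫ y, φ y ^ 2 ∂unif B) = c * ∫ y, φ y ^ 2 ∂unif B := by field_simp
  have h6 : ∫ y, φ y ^ 2 ∂unif B = 0 := by
    refine le_antisymm ?_ (integral_nonneg fun y => sq_nonneg _)
    have : c * ∫ y, φ y ^ 2 ∂unif B ≤ 0 := by linarith
    exact nonpos_of_mul_nonpos_right this hc0
  obtain ⟨x, hx⟩ := (ae_unif_mem hA).exists
  refine ((integral_eq_zero_iff_of_nonneg (fun y => sq_nonneg _) iφ).1 h6).mono fun y hy => ?_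
  exact (hS.mem_iff_infDist_zero ⟨_, hAS x hx⟩).2 (pow_eq_zero_iff two_ne_zero |>.1 hy)

/-! ### Solid bodies, support functions and the `L₀`-sum -/

/-- A set is solid if it is closed under decreasing the absolute values of the coordinates. -/
def IsSolid {n : ℕ} (A : Set (Fin n → ℝ)) : Prop :=
  ∀ x ∈ A, ∀ y : Fin n → ℝ, (∀ i, |y i| ≤ |x i|) → y ∈ A

/-- An unconditional convex body in coordinates. -/
structure IsSolidBody {n : ℕ} (A : Set (Fin n → ℝ)) : Prop where
  convex : Convex ℝ A
  isCompact : IsCompact A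
  solid : IsSolid A
  exists_const_mem : ∃ r : ℝ, 0 < r ∧ (fun _ => r) ∈ A

/-- The support function with respect to the dot product. -/
noncomputable def piSupport {n : ℕ} (A : Set (Fin n → ℝ)) (u : Fin n → ℝ) : ℝ :=
  sSup ((fun x => x ⬝ᵥ u) '' A)

/-- The `L₀`-sum with respect to the dot product. -/
noncomputable def piLogSum {n : ℕ} (t : ℝ) (A B : Set (Fin n → ℝ)) : Set (Fin n → ℝ) :=
  {x | ∀ u, x ⬝ᵥ u ≤ piSupport A u ^ (1 - t) * piSupport B u ^ t}

/-- The image of a set under a diagonal map. -/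
def diagImage {n : ℕ} (d : Fin n → ℝ) (A : Set (Fin n → ℝ)) : Set (Fin n → ℝ) :=
  (fun x => d * x) '' A

theorem continuous_dotProduct_left {n : ℕ} (u : Fin n → ℝ) :
    Continuous fun x : Fin n → ℝ => x ⬝ᵥ u := by
  unfold dotProduct; fun_prop

namespace IsSolidBody

variable {n : ℕ} {A B : Set (Fin n → ℝ)} {t : ℝ}

theorem nonempty (hA : IsSolidBody A) : A.Nonempty :=
  let ⟨_, _, h⟩ := hA.exists_const_mem; ⟨_, h⟩

theorem zero_mem (hA : IsSolidBody A) : (0 : Fin n → ℝ) ∈ A :=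
  let ⟨_, _, h⟩ := hA.exists_const_mem
  hA.solid _ h _ fun i => by simp

theorem dotProduct_le (hA : IsSolidBody A) {x : Fin n → ℝ} (hx : x ∈ A) (u : Fin n → ℝ) :
    x ⬝ᵥ u ≤ piSupport A u :=
  le_csSup (hA.isCompact.image (continuous_dotProduct_left u)).bddAbove ⟨x, hx, rfl⟩

theorem piSupport_le (hA : IsSolidBody A) {u : Fin n → ℝ} {c : ℝ} (h : ∀ x ∈ A, x ⬝ᵥ u ≤ c) :
    piSupport A u ≤ c :=
  csSup_le (hA.nonempty.image _) (by rintro _ ⟨x, hx, rfl⟩; exact h x hx)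

theorem piSupport_nonneg (hA : IsSolidBody A) (u : Fin n → ℝ) : 0 ≤ piSupport A u := by
  simpa using hA.dotProduct_le hA.zero_mem u

/-- By solidity the signs of the coordinates of `x` can be matched to those of `v`, which turns `x
⬝ᵥ v` into a sum of absolute values. -/
theorem piSupport_mono (hA : IsSolidBody A) {u v : Fin n → ℝ} (h : ∀ i, |u i| ≤ |v i|) :
    piSupport A u ≤ piSupport A v := by
  refine hA.piSupport_le fun x hx => ?_
  refine le_trans ?_ (hA.dotProduct_le (hA.solid x hx (fun i => |x i| * SignType.sign (v i)) ?_) v)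
  · refine Finset.sum_le_sum fun i _ => ?_
    have h1 : |x i| * SignType.sign (v i) * v i = |x i| * |v i| := by
      rw [mul_assoc, sign_mul_self]
    simp only [h1]
    calc x i * u i ≤ |x i * u i| := le_abs_self _
      _ = |x i| * |u i| := abs_mul _ _
      _ ≤ _ := mul_le_mul_of_nonneg_left (h i) (abs_nonneg _)
  · intro i
    rw [abs_mul, abs_abs]
    refine mul_le_of_le_one_right (abs_nonneg _) ?_
    rcases lt_trichotomy (v i) 0 with h | h | h <;> simp [h]

theorem piSupport_congr (hA : IsSolidBody A) {u v : Fin n → ℝ} (h : ∀ i, |u i| = |v i|) :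
    piSupport A u = piSupport A v :=
  le_antisymm (hA.piSupport_mono fun i => (h i).le) (hA.piSupport_mono fun i => (h i).ge)

theorem piSupport_pos (hA : IsSolidBody A) {u : Fin n → ℝ} (hu : u ≠ 0) : 0 < piSupport A u := by
  obtain ⟨r, hr, hrA⟩ := hA.exists_const_mem
  rw [← hA.piSupport_congr (u := fun i => |u i|) (fun i => abs_abs _)]
  refine lt_of_lt_of_le ?_ (hA.dotProduct_le hrA _)
  obtain ⟨i, hi⟩ := Function.ne_iff.1 hu
  exact Finset.sum_pos' (fun j _ => mul_nonneg hr.le (abs_nonneg _))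
    ⟨i, Finset.mem_univ _, mul_pos hr (abs_pos.2 hi)⟩

theorem continuous_piSupport (hA : IsSolidBody A) : Continuous (piSupport A) := by
  refine hA.isCompact.continuous_sSup (f := fun u x => x ⬝ᵥ u) ?_
  simp only [Function.HasUncurry.uncurry, dotProduct, id]
  fun_prop

theorem mem_of_forall_le (hA : IsSolidBody A) {x : Fin n → ℝ}
    (h : ∀ u, x ⬝ᵥ u ≤ piSupport A u) : x ∈ A := by
  by_contra hx
  obtain ⟨f, c, hc, hcx⟩ := geometric_hahn_banach_closed_point hA.convex hA.isCompact.isClosed hx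
  have hf : ∀ y, f y = y ⬝ᵥ fun i => f (Pi.single i 1) := by
    intro y
    have := LinearMap.pi_apply_eq_sum_univ (f : (Fin n → ℝ) →ₗ[ℝ] ℝ) y
    simp only [smul_eq_mul] at this
    refine this.trans (Finset.sum_congr rfl fun i _ => ?_)
    rw [show (fun j => if i = j then (1 : ℝ) else 0) = Pi.single i 1 by
      ext j; simp [Pi.single_apply, eq_comm]]
    rfl
  have h1 := h fun i => f (Pi.single i 1)
  have h2 : piSupport A (fun i => f (Pi.single i 1)) ≤ c :=
    hA.piSupport_le fun y hy => by rw [← hf]; exact (hc y hy).le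
  rw [← hf] at h1
  linarith

theorem exists_bound (hA : IsSolidBody A) : ∃ R : ℝ, 0 < R ∧ ∀ x ∈ A, ∀ i, |x i| ≤ R := by
  obtain ⟨R, hR⟩ := hA.isCompact.isBounded.exists_norm_le
  refine ⟨max R 1, by positivity, fun x hx i => ?_⟩
  exact (norm_le_pi_norm x i).trans ((hR x hx).trans (le_max_left _ _))

theorem diagImage (hA : IsSolidBody A) {d : Fin n → ℝ} (hd : ∀ i, 0 < d i) :
    IsSolidBody (diagImage d A) where
  convex := hA.convex.linear_image (LinearMap.mulLeft ℝ d)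
  isCompact := hA.isCompact.image (by fun_prop)
  solid := by
    rintro _ ⟨x, hx, rfl⟩ y hy
    refine ⟨fun i => (d i)⁻¹ * y i, hA.solid x hx _ fun i => ?_, ?_⟩
    · have := hy i
      simp only [Pi.mul_apply, abs_mul, abs_of_pos (hd i)] at this
      rw [abs_mul, abs_inv, abs_of_pos (hd i), inv_mul_le_iff₀ (hd i)]
      exact this
    · ext i
      simp [(hd i).ne']
  exists_const_mem := by
    obtain ⟨r, hr, hrA⟩ := hA.exists_const_mem
    obtain ⟨m, hm, hmd⟩ : ∃ m : ℝ, 0 < m ∧ ∀ i, m ≤ d i := by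
      rcases isEmpty_or_nonempty (Fin n) with h | h
      · exact ⟨1, one_pos, fun i => h.elim i⟩
      · obtain ⟨i, hi⟩ := Finite.exists_min d
        exact ⟨d i, hd i, hi⟩
    refine ⟨m * r, by positivity, fun i => (d i)⁻¹ * (m * r), hA.solid _ hrA _ fun i => ?_, ?_⟩
    · rw [abs_of_pos hr, abs_of_pos (mul_pos (inv_pos.2 (hd i)) (by positivity)),
        inv_mul_le_iff₀ (hd i)]
      exact mul_le_mul_of_nonneg_right (hmd i) hr.le
    · ext i
      simp [(hd i).ne']

theorem piSupport_diagImage (hA : IsSolidBody A) {d : Fin n → ℝ} (hd : ∀ i, 0 < d i)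
    (u : Fin n → ℝ) : piSupport (LogBM.diagImage d A) u = piSupport A (d * u) := by
  have e : ∀ x : Fin n → ℝ, (d * x) ⬝ᵥ u = x ⬝ᵥ (d * u) := fun x =>
    Finset.sum_congr rfl fun i _ => by simp only [Pi.mul_apply]; ring
  refine le_antisymm ((hA.diagImage hd).piSupport_le ?_) (hA.piSupport_le fun x hx => ?_)
  · rintro _ ⟨x, hx, rfl⟩
    simp only [e]
    exact hA.dotProduct_le hx _
  · rw [← e]
    exact (hA.diagImage hd).dotProduct_le ⟨x, hx, rfl⟩ _

theorem piSupport_smul (hA : IsSolidBody A) {c : ℝ} (hc : 0 < c) (u : Fin n → ℝ) :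
    piSupport A (c • u) = c * piSupport A u := by
  refine le_antisymm (hA.piSupport_le fun x hx => ?_) ?_
  · rw [dotProduct_smul, smul_eq_mul]
    exact mul_le_mul_of_nonneg_left (hA.dotProduct_le hx u) hc.le
  · rw [← le_inv_mul_iff₀ hc]
    refine hA.piSupport_le fun x hx => ?_
    rw [le_inv_mul_iff₀ hc, ← smul_eq_mul, ← dotProduct_smul]
    exact hA.dotProduct_le hx _

/-- Hölder's inequality with exponents `1 / (1 - t)` and `1 / t` for the products `x i * |u i|` and
`y i * |u i|`; solidity allows `u` to be replaced by `|u|`. -/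
theorem geomMean_mem_piLogSum (hA : IsSolidBody A) (hB : IsSolidBody B) (ht0 : 0 < t) (ht1 : t < 1)
    {x y : Fin n → ℝ} (hx : x ∈ A) (hy : y ∈ B) (hx0 : ∀ i, 0 ≤ x i) (hy0 : ∀ i, 0 ≤ y i) :
    geomMean t x y ∈ piLogSum t A B := by
  have hs : 0 < 1 - t := by linarith
  intro u
  rw [← hA.piSupport_congr (u := fun i => |u i|) (fun i => abs_abs _),
    ← hB.piSupport_congr (u := fun i => |u i|) (fun i => abs_abs _)]
  have hp : (1 - t)⁻¹.HolderConjugate t⁻¹ := by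
    rw [Real.holderConjugate_iff]
    exact ⟨(one_lt_inv₀ hs).2 (by linarith), by simp⟩
  have h := Real.inner_le_Lp_mul_Lq_of_nonneg Finset.univ hp
    (f := fun i => (x i * |u i|) ^ (1 - t)) (g := fun i => (y i * |u i|) ^ t)
    (fun i _ => Real.rpow_nonneg (mul_nonneg (hx0 i) (abs_nonneg _)) _)
    (fun i _ => Real.rpow_nonneg (mul_nonneg (hy0 i) (abs_nonneg _)) _)
  have e1 : ∀ i, ((x i * |u i|) ^ (1 - t)) ^ (1 - t)⁻¹ = x i * |u i| := fun i =>
    Real.rpow_rpow_inv (mul_nonneg (hx0 i) (abs_nonneg _)) hs.ne'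
  have e2 : ∀ i, ((y i * |u i|) ^ t) ^ t⁻¹ = y i * |u i| := fun i =>
    Real.rpow_rpow_inv (mul_nonneg (hy0 i) (abs_nonneg _)) ht0.ne'
  simp only [e1, e2, one_div, inv_inv] at h
  refine le_trans (Finset.sum_le_sum fun i _ => ?_) (h.trans ?_)
  · rw [Real.mul_rpow (hx0 i) (abs_nonneg _), Real.mul_rpow (hy0 i) (abs_nonneg _),
      mul_mul_mul_comm, ← Real.rpow_add' (abs_nonneg _) (by simp)]
    simp only [sub_add_cancel, Real.rpow_one]
    exact mul_le_mul_of_nonneg_left (le_abs_self _)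
      (mul_nonneg (Real.rpow_nonneg (hx0 i) _) (Real.rpow_nonneg (hy0 i) _))
  · have h1 := hA.dotProduct_le hx fun i => |u i|
    have h2 := hB.dotProduct_le hy fun i => |u i|
    simp only [dotProduct] at h1 h2
    have p1 : 0 ≤ ∑ i, x i * |u i| :=
      Finset.sum_nonneg fun i _ => mul_nonneg (hx0 i) (abs_nonneg _)
    have p2 : 0 ≤ ∑ i, y i * |u i| :=
      Finset.sum_nonneg fun i _ => mul_nonneg (hy0 i) (abs_nonneg _)
    exact mul_le_mul (Real.rpow_le_rpow p1 h1 hs.le) (Real.rpow_le_rpow p2 h2 ht0.le)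
      (Real.rpow_nonneg p2 _) (Real.rpow_nonneg (hA.piSupport_nonneg _) _)

theorem solid_piLogSum (hA : IsSolidBody A) (hB : IsSolidBody B) : IsSolid (piLogSum t A B) := by
  intro x hx y hy u
  set v : Fin n → ℝ := fun i => (if x i < 0 then -1 else 1) * |u i| with hv
  have hva : ∀ i, |v i| = |u i| := by
    intro i
    simp only [hv]
    split_ifs <;> simp
  rw [← hA.piSupport_congr hva, ← hB.piSupport_congr hva]
  refine le_trans (Finset.sum_le_sum fun i _ => ?_) (hx v)
  have h1 : x i * v i = |x i| * |u i| := by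
    simp only [hv]
    split_ifs with h
    · rw [abs_of_neg h]; ring
    · rw [abs_of_nonneg (not_lt.1 h)]; ring
  rw [h1]
  calc y i * u i ≤ |y i * u i| := le_abs_self _
    _ = |y i| * |u i| := abs_mul _ _
    _ ≤ _ := mul_le_mul_of_nonneg_right (hy i) (abs_nonneg _)

theorem piLogSum (hA : IsSolidBody A) (hB : IsSolidBody B) (ht0 : 0 < t) (ht1 : t < 1) :
    IsSolidBody (piLogSum t A B) := by
  have eq : LogBM.piLogSum t A B
      = ⋂ u, {x | x ⬝ᵥ u ≤ piSupport A u ^ (1 - t) * piSupport B u ^ t} := by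
    ext x; simp [LogBM.piLogSum]
  have hcl : IsClosed (LogBM.piLogSum t A B) := by
    rw [eq]
    exact isClosed_iInter fun u => isClosed_le (continuous_dotProduct_left u) continuous_const
  refine ⟨?_, ?_, solid_piLogSum hA hB, ?_⟩
  · rw [eq]
    refine convex_iInter fun u => convex_halfSpace_le ⟨fun x y => ?_, fun c x => ?_⟩ _
    · exact add_dotProduct x y u
    · exact smul_dotProduct c x u
  · set M := fun u => piSupport A u ^ (1 - t) * piSupport B u ^ t with hM
    refine (isCompact_Icc (a := fun i => -M (Pi.single i (-1))) (b := fun i => M (Pi.single i 1))).of_isClosed_subset hcl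
      fun x hx => ⟨fun i => ?_, fun i => ?_⟩
    · have := hx (Pi.single i (-1))
      rw [dotProduct_single] at this
      simp only [hM]
      linarith
    · have := hx (Pi.single i 1)
      rw [dotProduct_single] at this
      simp only [hM]
      linarith
  · obtain ⟨r, hr, hrA⟩ := hA.exists_const_mem
    obtain ⟨s, hs, hsB⟩ := hB.exists_const_mem
    exact ⟨r ^ (1 - t) * s ^ t, by positivity,
      hA.geomMean_mem_piLogSum hB ht0 ht1 hrA hsB (fun _ => hr.le) (fun _ => hs.le)⟩

theorem measurableSet (hA : IsSolidBody A) : MeasurableSet A := hA.isCompact.measurableSet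

/-- The convex combinations of `|x|` with a small cube diagonal approximate `|x|` from inside. -/
theorem combination_mem (hA : IsSolidBody A) {r : ℝ} (hrA : (fun _ => r) ∈ A) {x : Fin n → ℝ}
    (hx : x ∈ A) {s : ℝ} (hs0 : 0 ≤ s) (hs1 : s ≤ 1) :
    (fun i => s * |x i| + (1 - s) * r) ∈ A := by
  have h := hA.convex (hA.solid x hx (fun i => |x i|) fun i => (abs_abs _).le) hrA hs0
    (sub_nonneg.2 hs1) (by ring)
  exact h

theorem volume_inter_posOrthant_ne_zero (hA : IsSolidBody A) :
    volume (A ∩ posOrthant n) ≠ 0 := by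
  obtain ⟨r, hr, hrA⟩ := hA.exists_const_mem
  have hsub : (Set.pi univ fun _ : Fin n => Ioo 0 r) ⊆ A ∩ posOrthant n := by
    intro x hx
    simp only [mem_pi, mem_univ, forall_const, mem_Ioo] at hx
    exact ⟨hA.solid _ hrA _ fun i => by
      rw [abs_of_pos (hx i).1, abs_of_pos hr]; exact (hx i).2.le,
      mem_posOrthant.2 fun i => (hx i).1⟩
  refine fun h => (measure_mono_null hsub h).not_gt ?_
  rw [volume_pi_pi]
  simp [hr, pos_iff_ne_zero]

end IsSolidBody

/-- Reflecting one coordinate at a time preserves the volume and a solid set, so each positivity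
constraint halves the volume; the hyperplanes are null. -/
theorem volume_eq_two_pow_mul {n : ℕ} {A : Set (Fin n → ℝ)} (hA : MeasurableSet A)
    (hs : IsSolid A) : volume A = 2 ^ n * volume (A ∩ posOrthant n) := by
  have key : ∀ S : Finset (Fin n),
      volume A = 2 ^ S.card * volume (A ∩ {x | ∀ i ∈ S, 0 < x i}) := by
    intro S
    induction S using Finset.induction_on with
    | empty => simp
    | insert j S hj ih =>
      rw [ih, Finset.card_insert_of_notMem hj, pow_succ, mul_assoc]
      congr 1
      set T := A ∩ {x | ∀ i ∈ S, 0 < x i} with hT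
      have mT : MeasurableSet T := by
        refine hA.inter ?_
        have : {x : Fin n → ℝ | ∀ i ∈ S, 0 < x i} = ⋂ i ∈ S, {x | 0 < x i} := by ext; simp
        rw [this]
        exact S.measurableSet_biInter fun i _ =>
          measurableSet_lt measurable_const (measurable_pi_apply i)
      have e : A ∩ {x | ∀ i ∈ insert j S, 0 < x i} = T ∩ {x | 0 < x j} := by
        ext x; simp [hT, and_assoc, and_comm (a := 0 < x j)]
      have mpos : MeasurableSet {x : Fin n → ℝ | 0 < x j} :=
        measurableSet_lt measurable_const (measurable_pi_apply j)
      have mneg : MeasurableSet {x : Fin n → ℝ | x j < 0} :=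
        measurableSet_lt (measurable_pi_apply j) measurable_const
      set F : (Fin n → ℝ) → Fin n → ℝ := fun x i => (if i = j then Neg.neg else id) (x i) with hF
      have mpF : MeasurePreserving F volume volume := by
        refine volume_preserving_pi (f := fun i => if i = j then Neg.neg else id) fun i => ?_
        split_ifs
        · exact Measure.measurePreserving_neg volume
        · exact MeasurePreserving.id _
      have hFabs : ∀ x i, |F x i| = |x i| := by
        intro x i
        simp only [hF]
        split_ifs <;> simp
      have pre : F ⁻¹' (T ∩ {x | 0 < x j}) = T ∩ {x | x j < 0} := by
        ext x
        have h1 : F x ∈ A ↔ x ∈ A :=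
          ⟨fun h => hs _ h _ fun i => (hFabs x i).ge, fun h => hs _ h _ fun i => (hFabs x i).le⟩
        have h2 : (∀ i ∈ S, 0 < F x i) ↔ ∀ i ∈ S, 0 < x i := by
          refine forall₂_congr fun i hi => ?_
          have : i ≠ j := fun h => hj (h ▸ hi)
          simp [hF, this]
        have h3 : 0 < F x j ↔ x j < 0 := by simp [hF]
        simp only [hT, mem_preimage, mem_inter_iff, mem_ofPred_eq, h1, h2, h3]
      have hv : volume (T ∩ {x | x j < 0}) = volume (T ∩ {x | 0 < x j}) := by
        rw [← pre, mpF.measure_preimage (mT.inter mpos).nullMeasurableSet]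
      have hz : volume (T ∩ {x | x j = 0}) = 0 :=
        measure_mono_null inter_subset_right (Measure.pi_hyperplane _ j 0)
      have hsplit : volume T
          = volume (T ∩ {x | 0 < x j}) + volume (T ∩ {x | x j < 0}) := by
        rw [← measure_inter_add_sdiff T mpos]
        congr 1
        refine le_antisymm ?_ (measure_mono fun x hx => ⟨hx.1, fun h => lt_asymm (show 0 < x j from h) hx.2⟩)
        calc volume (T \ {x | 0 < x j})
            ≤ volume (T ∩ {x | x j < 0} ∪ T ∩ {x | x j = 0}) := by
              refine measure_mono fun x hx => ?_
              rcases lt_or_eq_of_le (not_lt.1 (show ¬0 < x j from hx.2)) with h | h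
              · exact .inl ⟨hx.1, h⟩
              · exact .inr ⟨hx.1, h⟩
          _ ≤ _ := (measure_union_le _ _).trans_eq (by rw [hz, add_zero])
      rw [e, hsplit, hv, two_mul]
  have h := key Finset.univ
  rw [Finset.card_univ, Fintype.card_fin] at h
  rw [h]
  congr 3
  ext x
  simp [mem_posOrthant]

/-! ### Equality forces a diagonal map -/

theorem mem_of_forall_Ioo {E : Type*} [TopologicalSpace E] {T : Set E} (hT : IsClosed T)
    {F : ℝ → E} (hF : Continuous F) (h : ∀ s ∈ Ioo (0 : ℝ) 1, F s ∈ T) : F 1 ∈ T :=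
  hT.mem_of_tendsto ((hF.tendsto 1).mono_left nhdsWithin_le_nhds)
    (Filter.mem_of_superset (Ioo_mem_nhdsLT zero_lt_one) h)

namespace IsSolidBody

variable {n : ℕ} {A B : Set (Fin n → ℝ)} {t : ℝ}

theorem exists_const_mem_interior (hA : IsSolidBody A) :
    ∃ r : ℝ, 0 < r ∧ (fun _ => r) ∈ interior A := by
  obtain ⟨r, hr, hrA⟩ := hA.exists_const_mem
  refine ⟨r / 2, by positivity, mem_interior.2 ⟨Set.pi univ fun _ => Ioo 0 r, fun x hx => ?_,
    isOpen_set_pi finite_univ fun _ _ => isOpen_Ioo, ?_⟩⟩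
  · simp only [mem_pi, mem_univ, forall_const, mem_Ioo] at hx
    exact hA.solid _ hrA _ fun i => by
      rw [abs_of_pos (hx i).1, abs_of_pos hr]; exact (hx i).2.le
  · simp only [mem_pi, mem_univ, forall_const, mem_Ioo]
    exact fun _ => ⟨by positivity, by linarith⟩

/-- The exceptional part of the interior is open and null, hence empty. Every `|y|` is a limit of
strictly positive interior points, obtained by moving it towards a constant interior point. -/
theorem abs_mem_of_ae (hB : IsSolidBody B) {T : Set (Fin n → ℝ)} (hT : IsClosed T)
    (h : ∀ᵐ y ∂unif (B ∩ posOrthant n), y ∈ T) {y : Fin n → ℝ} (hy : y ∈ B) :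
    (fun i => |y i|) ∈ T := by
  have hfin : volume (B ∩ posOrthant n) ≠ ∞ :=
    ne_top_of_le_ne_top hB.isCompact.measure_ne_top (measure_mono inter_subset_left)
  have hpos : IsOpen (posOrthant n) := isOpen_set_pi finite_univ fun _ _ => isOpen_Ioi
  set U := interior B ∩ posOrthant n ∩ Tᶜ with hU
  have hUo : IsOpen U := (isOpen_interior.inter hpos).inter hT.isOpen_compl
  have hU0 : U = ∅ := by
    refine (hUo.measure_eq_zero_iff volume).1 ?_
    have h1 : unif (B ∩ posOrthant n) Tᶜ = 0 := h
    rw [unif, Measure.smul_apply, smul_eq_mul, mul_eq_zero,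
      Measure.restrict_apply hT.isOpen_compl.measurableSet] at h1
    refine measure_mono_null (fun x hx => ?_)
      (h1.resolve_left (ENNReal.inv_ne_zero.2 hfin))
    exact ⟨hx.2, interior_subset hx.1.1, hx.1.2⟩
  obtain ⟨r, hr, hrB⟩ := hB.exists_const_mem_interior
  have := mem_of_forall_Ioo hT (F := fun s i => s * |y i| + (1 - s) * r) (by fun_prop)
    fun s hs => by
      by_contra hsT
      have hmem : (fun i => s * |y i| + (1 - s) * r) ∈ U := by
        refine ⟨⟨?_, mem_posOrthant.2 fun i => ?_⟩, hsT⟩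
        · exact hB.convex.combo_self_interior_mem_interior
            (hB.solid y hy (fun i => |y i|) fun i => (abs_abs _).le) hrB hs.1.le
            (sub_pos.2 hs.2) (by ring)
        · have := mul_pos (sub_pos.2 hs.2) hr
          have := mul_nonneg hs.1.le (abs_nonneg (y i))
          linarith
      rw [hU0] at hmem
      exact hmem
  simpa using this

/-- The open set `interior B \ A` is null, hence empty, and `B` is the closure of its interior. -/
theorem eq_of_subset_of_volume_eq (hA : IsSolidBody A) (hB : IsSolidBody B) (hAB : A ⊆ B)
    (hv : volume B = volume A) : A = B := by
  refine hAB.antisymm ?_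
  have h0 : interior B ∩ Aᶜ = ∅ := by
    refine ((isOpen_interior.inter hA.isCompact.isClosed.isOpen_compl).measure_eq_zero_iff
      volume).1 (measure_mono_null (t := B \ A) (fun x hx => ⟨interior_subset hx.1, hx.2⟩) ?_)
    rw [measure_sdiff hAB hA.measurableSet.nullMeasurableSet hA.isCompact.measure_ne_top, hv,
      tsub_self]
  obtain ⟨r, _, hr⟩ := hB.exists_const_mem_interior
  have h1 := hB.convex.closure_interior_eq_closure_of_nonempty_interior ⟨_, hr⟩
  rw [hB.isCompact.isClosed.closure_eq] at h1
  rw [← h1]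
  exact closure_minimal (fun x hx => by_contra fun hxA => (h0 ▸ ⟨hx, hxA⟩ : x ∈ (∅ : Set _)))
    hA.isCompact.isClosed

theorem div_mem_of_volume_eq (hA : IsSolidBody A) (hB : IsSolidBody B) (ht0 : 0 < t) (ht1 : t < 1)
    (hv : volume (LogBM.piLogSum t A B) = volume A ^ (1 - t) * volume B ^ t) {y : Fin n → ℝ}
    (hy : y ∈ B) :
    (fun i => (∫ x, x i ∂unif (A ∩ posOrthant n)) * (y i / ∫ x, x i ∂unif (B ∩ posOrthant n)))
      ∈ A := by
  have hs : 0 < 1 - t := by linarith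
  have hC := hA.piLogSum hB ht0 ht1
  have mp := measurableSet_posOrthant n
  have fin : ∀ {D : Set (Fin n → ℝ)}, IsSolidBody D → volume (D ∩ posOrthant n) ≠ ∞ := fun hD =>
    ne_top_of_le_ne_top hD.isCompact.measure_ne_top (measure_mono inter_subset_left)
  -- The factors `2 ^ n` from the orthants cancel because the exponents `1 - t` and `t` add up to 1.
  have hv' : volume (LogBM.piLogSum t A B ∩ posOrthant n)
      = volume (A ∩ posOrthant n) ^ (1 - t) * volume (B ∩ posOrthant n) ^ t := by
    rw [volume_eq_two_pow_mul hC.measurableSet hC.solid,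
      volume_eq_two_pow_mul hA.measurableSet hA.solid,
      volume_eq_two_pow_mul hB.measurableSet hB.solid, ENNReal.mul_rpow_of_nonneg _ _ hs.le,
      ENNReal.mul_rpow_of_nonneg _ _ ht0.le, mul_mul_mul_comm,
      ← ENNReal.rpow_add _ _ (by simp) (by simp)] at hv
    simp only [sub_add_cancel, ENNReal.rpow_one] at hv
    exact (ENNReal.mul_right_inj (by simp) (by simp)).1 hv
  obtain ⟨RA, hRA0, hRA⟩ := hA.exists_bound
  obtain ⟨RB, hRB0, hRB⟩ := hB.exists_bound
  obtain ⟨RC, hRC0, hRC⟩ := hC.exists_bound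
  have box : ∀ {D : Set (Fin n → ℝ)} {R : ℝ}, (∀ x ∈ D, ∀ i, |x i| ≤ R) →
      R ≤ max RA (max RB RC) → D ∩ posOrthant n ⊆ Icc 0 fun _ => max RA (max RB RC) := by
    intro D R hD hR x hx
    exact ⟨fun i => (mem_posOrthant.1 hx.2 i).le,
      fun i => (le_abs_self _).trans ((hD x hx.1 i).trans hR)⟩
  have hαpos := integral_apply_unif_pos (hA.measurableSet.inter mp)
    hA.volume_inter_posOrthant_ne_zero (fin hA) inter_subset_right (box hRA (le_max_left _ _))
  have hβpos := integral_apply_unif_pos (hB.measurableSet.inter mp)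
    hB.volume_inter_posOrthant_ne_zero (fin hB) inter_subset_right
    (box hRB ((le_max_left _ _).trans (le_max_right _ _)))
  set α : Fin n → ℝ := fun i => ∫ x, x i ∂unif (A ∩ posOrthant n) with hα
  set β : Fin n → ℝ := fun i => ∫ x, x i ∂unif (B ∩ posOrthant n) with hβ
  have cont : Continuous fun X : Fin n → ℝ => fun i => α i * X i := by fun_prop
  have cont' : Continuous fun y : Fin n → ℝ => fun i => y i / β i :=
    continuous_pi fun i => (continuous_apply i).div_const _
  -- This is the set `S` of the rigidity result: the whole body `A` rescaled by its orthant
  -- barycenter.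
  have hcl : IsClosed {X : Fin n → ℝ | (fun i => α i * X i) ∈ A} :=
    hA.isCompact.isClosed.preimage cont
  have hae := ae_mem_of_volume_eq ht0 ht1 (hA.measurableSet.inter mp) (hB.measurableSet.inter mp)
    (hC.measurableSet.inter mp) inter_subset_right inter_subset_right inter_subset_right
    hA.volume_inter_posOrthant_ne_zero (fin hA) hB.volume_inter_posOrthant_ne_zero (fin hB)
    (box hRA (le_max_left _ _)) (box hRB ((le_max_left _ _).trans (le_max_right _ _)))
    (box hRC ((le_max_right _ _).trans (le_max_right _ _)))
    (fun x hx y hy => ⟨hA.geomMean_mem_piLogSum hB ht0 ht1 hx.1 hy.1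
      (fun i => (mem_posOrthant.1 hx.2 i).le) (fun i => (mem_posOrthant.1 hy.2 i).le),
      mem_posOrthant.2 fun i => mul_pos (Real.rpow_pos_of_pos (mem_posOrthant.1 hx.2 i) _)
        (Real.rpow_pos_of_pos (mem_posOrthant.1 hy.2 i) _)⟩) hv' hcl
    fun x hx => by
      have : (fun i => α i * (x i / α i)) = x := by
        ext i
        exact mul_div_cancel₀ _ (hαpos i).ne'
      change (fun i => α i * (x i / α i)) ∈ A
      rw [this]
      exact hx.1
  have := hB.abs_mem_of_ae (hcl.preimage cont') hae hy
  refine hA.solid _ this _ fun i => ?_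
  rw [abs_mul, abs_mul, abs_div, abs_div, abs_abs]

theorem piLogSum_symm : LogBM.piLogSum (1 - t) B A = LogBM.piLogSum t A B := by
  ext x
  simp only [LogBM.piLogSum, sub_sub_cancel, mul_comm]

/-- In the equality case, the two bodies differ by a diagonal map. -/
theorem eq_diagImage_of_volume_eq (hA : IsSolidBody A) (hB : IsSolidBody B) (ht0 : 0 < t)
    (ht1 : t < 1) (hv : volume (LogBM.piLogSum t A B) = volume A ^ (1 - t) * volume B ^ t) :
    ∃ d : Fin n → ℝ, (∀ i, 0 < d i) ∧ B = LogBM.diagImage d A := by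
  have mp := measurableSet_posOrthant n
  have pos : ∀ {D : Set (Fin n → ℝ)}, IsSolidBody D →
      ∀ i, 0 < ∫ x, x i ∂unif (D ∩ posOrthant n) := by
    intro D hD
    obtain ⟨R, _, hR⟩ := hD.exists_bound
    exact integral_apply_unif_pos (hD.measurableSet.inter mp) hD.volume_inter_posOrthant_ne_zero
      (ne_top_of_le_ne_top hD.isCompact.measure_ne_top (measure_mono inter_subset_left))
      inter_subset_right (R := R) fun x hx => ⟨fun i => (mem_posOrthant.1 hx.2 i).le,
        fun i => (le_abs_self _).trans (hR x hx.1 i)⟩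
  have hv' : volume (LogBM.piLogSum (1 - t) B A)
      = volume B ^ (1 - (1 - t)) * volume A ^ (1 - t) := by
    rw [piLogSum_symm, hv, sub_sub_cancel, mul_comm]
  have hα := pos hA
  have hβ := pos hB
  refine ⟨fun i => (∫ x, x i ∂unif (B ∩ posOrthant n)) / ∫ x, x i ∂unif (A ∩ posOrthant n),
    fun i => div_pos (hβ i) (hα i), ?_⟩
  ext y
  constructor
  · intro hy
    refine ⟨_, hA.div_mem_of_volume_eq hB ht0 ht1 hv hy, ?_⟩
    ext i
    have := (hα i).ne'
    have := (hβ i).ne'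
    simp only [Pi.mul_apply]
    field_simp
  · rintro ⟨x, hx, rfl⟩
    have := hB.div_mem_of_volume_eq hA (sub_pos.2 ht1) (by linarith) hv' hx
    convert! this using 1
    ext i
    simp only [Pi.mul_apply]
    ring

theorem volume_diagImage (d : Fin n → ℝ) (hd : ∀ i, 0 < d i) (A : Set (Fin n → ℝ)) :
    volume (LogBM.diagImage d A) = ENNReal.ofReal (∏ i, d i) * volume A := by
  have h := Measure.addHaar_image_linearMap volume (Matrix.toLin' (Matrix.diagonal d)) A
  rw [LinearMap.det_toLin', Matrix.det_diagonal,
    abs_of_pos (Finset.prod_pos fun i _ => hd i)] at h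
  rw [← h, LogBM.diagImage]
  congr 2
  ext x i
  simp [Matrix.mulVec_diagonal]

/-- The geometric mean of `|x|` and `d * |x|` is `d ^ t * |x|`; solidity restores the signs. -/
theorem diagImage_rpow_subset_piLogSum (hA : IsSolidBody A) (ht0 : 0 < t) (ht1 : t < 1)
    {d : Fin n → ℝ} (hd : ∀ i, 0 < d i) :
    LogBM.diagImage (fun i => d i ^ t) A ⊆ LogBM.piLogSum t A (LogBM.diagImage d A) := by
  rintro _ ⟨x, hx, rfl⟩
  have hB := hA.diagImage hd
  have hx' : (fun i => |x i|) ∈ A := hA.solid x hx _ fun i => (abs_abs _).le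
  refine solid_piLogSum hA hB _ (hA.geomMean_mem_piLogSum hB ht0 ht1 hx' ⟨_, hx', rfl⟩
    (fun i => abs_nonneg _) fun i => mul_nonneg (hd i).le (abs_nonneg _)) _ fun i => ?_
  simp only [geomMean, Pi.mul_apply]
  rw [Real.mul_rpow (hd i).le (abs_nonneg _), mul_left_comm, ← Real.rpow_add' (abs_nonneg _)
    (by simp), abs_mul, abs_mul]
  simp

theorem volume_diagImage_rpow (ht0 : 0 < t) (ht1 : t < 1)
    {d : Fin n → ℝ} (hd : ∀ i, 0 < d i) :
    volume (LogBM.diagImage (fun i => d i ^ t) A)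
      = volume A ^ (1 - t) * volume (LogBM.diagImage d A) ^ t := by
  have hs : 0 < 1 - t := by linarith
  rw [volume_diagImage _ fun i => Real.rpow_pos_of_pos (hd i) t, volume_diagImage _ hd,
    ENNReal.mul_rpow_of_nonneg _ _ ht0.le, mul_left_comm, ← ENNReal.rpow_add_of_nonneg _ _ hs.le
    ht0.le, ENNReal.ofReal_rpow_of_pos (Finset.prod_pos fun i _ => hd i),
    Real.finsetProd_rpow _ _ fun i _ => (hd i).le]
  simp

end IsSolidBody

/-! ### Splitting along the level sets of the diagonal map -/

/-- The orthogonal projection to the coordinates on which `d` takes the value `c`. -/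
noncomputable def levelProj {n : ℕ} (d : Fin n → ℝ) (c : ℝ) (x : Fin n → ℝ) : Fin n → ℝ :=
  fun i => if d i = c then x i else 0

namespace IsSolidBody

variable {n : ℕ} {A B : Set (Fin n → ℝ)} {t : ℝ}

/-- The equality case in the weighted Hölder inequality. -/
theorem eq_of_sum_rpow_mul_eq (ht0 : 0 < t) (ht1 : t < 1) {d p : Fin n → ℝ} (hd : ∀ i, 0 < d i)
    (hp : ∀ i, 0 ≤ p i) (hp0 : 0 < ∑ i, p i)
    (h : (∑ i, p i) ^ (1 - t) * (∑ i, d i * p i) ^ t ≤ ∑ i, d i ^ t * p i) :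
    ∃ c, 0 < c ∧ ∀ i, p i ≠ 0 → d i = c := by
  set S := ∑ i, p i
  set W := ∑ i, d i * p i with hW
  have hW0 : 0 < W := by
    obtain ⟨i, -, hi⟩ := Finset.exists_ne_zero_of_sum_ne_zero hp0.ne'
    exact Finset.sum_pos' (fun j _ => mul_nonneg (hd j).le (hp j))
      ⟨i, Finset.mem_univ _, mul_pos (hd i) (lt_of_le_of_ne (hp i) (Ne.symm hi))⟩
  -- This is the mean of `d` with weights `p`. With this choice the hypothesis says that the
  -- weighted AM–GM deficits of the pairs `1`, `d i / c` have nonpositive sum, so each of them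
  -- vanishes.
  set c := W / S with hc
  have hc0 : 0 < c := div_pos hW0 hp0
  refine ⟨c, hc0, ?_⟩
  have hcS : S ^ (1 - t) * W ^ t = c ^ t * S := by
    rw [hc, Real.div_rpow hW0.le hp0.le, Real.rpow_sub hp0, Real.rpow_one]
    field_simp
  have hdef : ∀ i, min t (1 - t) * (√1 - √(d i / c)) ^ 2
      ≤ (1 - t) + t * (d i / c) - d i ^ t / c ^ t := by
    intro i
    have := min_mul_sq_sqrt_sub_le ht0 ht1 zero_le_one (div_nonneg (hd i).le hc0.le)
    rwa [Real.one_rpow, Real.div_rpow (hd i).le hc0.le, mul_one, one_mul] at this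
  have hm : 0 < min t (1 - t) := lt_min ht0 (by linarith)
  have hsum : ∑ i, ((1 - t) + t * (d i / c) - d i ^ t / c ^ t) * p i ≤ 0 := by
    have e : ∑ i, ((1 - t) + t * (d i / c) - d i ^ t / c ^ t) * p i
        = (1 - t) * S + t / c * W - (∑ i, d i ^ t * p i) / c ^ t := by
      rw [hW, Finset.mul_sum, Finset.mul_sum, Finset.sum_div, ← Finset.sum_add_distrib,
        ← Finset.sum_sub_distrib]
      exact Finset.sum_congr rfl fun i _ => by ring
    have e2 : t / c * W = t * S := by
      rw [hc]; field_simp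
    have hct : 0 < c ^ t := Real.rpow_pos_of_pos hc0 t
    have h3 : S ≤ (∑ i, d i ^ t * p i) / c ^ t := by
      rw [le_div_iff₀ hct, mul_comm]
      linarith
    rw [e, e2]
    linarith
  have hnn : ∀ i, 0 ≤ ((1 - t) + t * (d i / c) - d i ^ t / c ^ t) * p i := fun i =>
    mul_nonneg ((mul_nonneg hm.le (sq_nonneg _)).trans (hdef i)) (hp i)
  have hz := (Finset.sum_eq_zero_iff_of_nonneg fun i _ => hnn i).1
    (le_antisymm hsum (Finset.sum_nonneg fun i _ => hnn i))
  intro i hi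
  have h4 := (mul_eq_zero.1 (hz i (Finset.mem_univ i))).resolve_right hi
  have h5 := hdef i
  rw [h4] at h5
  have h6 : (√1 - √(d i / c)) ^ 2 = 0 :=
    le_antisymm (nonpos_of_mul_nonpos_right h5 hm) (sq_nonneg _)
  have h7 : √(d i / c) = √1 := by
    have := pow_eq_zero_iff two_ne_zero |>.1 h6
    linarith
  rw [Real.sqrt_one, Real.sqrt_eq_one, div_eq_one_iff_eq hc0.ne'] at h7
  exact h7

/-- If `x ∉ A`, then `d ^ t * x` is outside the `L₀`-sum. Scaling it back to the boundary by the
largest ratio `ρ > 1` gives equality in Hölder for a maximizing direction `a`. Positivity of `x`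
then confines the support of `a` to one level of `d`, where the level projection gives `x ⬝ᵥ a ≤
piSupport A a`, against `x ⬝ᵥ a = ρ * piSupport A a`. -/
theorem mem_of_levelProj_mem_of_pos (hA : IsSolidBody A) (ht0 : 0 < t) (ht1 : t < 1)
    {d : Fin n → ℝ} (hd : ∀ i, 0 < d i)
    (hC : LogBM.piLogSum t A (LogBM.diagImage d A) = LogBM.diagImage (fun i => d i ^ t) A)
    {x : Fin n → ℝ} (hx0 : ∀ i, 0 < x i) (hx : ∀ j, levelProj d (d j) x ∈ A) : x ∈ A := by
  have hs : 0 < 1 - t := by linarith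
  have hB := hA.diagImage hd
  have hdt : ∀ i, 0 < d i ^ t := fun i => Real.rpow_pos_of_pos (hd i) t
  by_contra hxA
  set H : (Fin n → ℝ) → ℝ := fun u => piSupport A u ^ (1 - t)
    * piSupport (LogBM.diagImage d A) u ^ t with hH
  have hHpos : ∀ u, u ≠ 0 → 0 < H u := fun u hu =>
    mul_pos (Real.rpow_pos_of_pos (hA.piSupport_pos hu) _)
      (Real.rpow_pos_of_pos (hB.piSupport_pos hu) _)
  have hHc : Continuous H := (hA.continuous_piSupport.rpow_const fun _ => .inr hs.le).mul
    (hB.continuous_piSupport.rpow_const fun _ => .inr ht0.le)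
  have hHsmul : ∀ c : ℝ, 0 < c → ∀ u, H (c • u) = c * H u := by
    intro c hc u
    simp only [hH]
    rw [hA.piSupport_smul hc, hB.piSupport_smul hc, Real.mul_rpow hc.le (hA.piSupport_nonneg u),
      Real.mul_rpow hc.le (hB.piSupport_nonneg u), mul_mul_mul_comm, ← Real.rpow_add hc]
    simp
  set y : Fin n → ℝ := fun i => d i ^ t * x i with hy
  have hyC : y ∉ LogBM.piLogSum t A (LogBM.diagImage d A) := by
    rw [hC]
    rintro ⟨x', hx', h⟩
    refine hxA ?_
    convert hx'
    ext i
    have := congrFun h i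
    simp only [Pi.mul_apply, hy] at this
    exact (mul_left_cancel₀ (hdt i).ne' this).symm
  obtain ⟨v, hv⟩ : ∃ v, H v < y ⬝ᵥ v := by
    by_contra! h
    exact hyC h
  have hv0 : v ≠ 0 := by
    rintro rfl
    have h0 : piSupport A (0 : Fin n → ℝ) = 0 :=
      le_antisymm (hA.piSupport_le fun z _ => by simp) (hA.piSupport_nonneg _)
    simp [hH, h0, hs.ne'] at hv
  -- the direction in which the ratio of `y ⬝ᵥ u` and `H u` is largest
  obtain ⟨u, hu1, hu⟩ : ∃ u ∈ Metric.sphere (0 : Fin n → ℝ) 1,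
      IsMaxOn (fun u => y ⬝ᵥ u / H u) (Metric.sphere 0 1) u := by
    refine (isCompact_sphere _ _).exists_isMaxOn ⟨‖v‖⁻¹ • v, ?_⟩ ?_
    · simp [norm_smul, hv0]
    · have hyc : Continuous fun u => y ⬝ᵥ u := by
        simp only [dotProduct]; fun_prop
      refine hyc.continuousOn.div hHc.continuousOn fun u hu => (hHpos u ?_).ne'
      rintro rfl
      rw [mem_sphere_zero_iff_norm, norm_zero] at hu
      exact zero_ne_one hu
  have hu0 : u ≠ 0 := by
    rintro rfl
    simp at hu1
  set ρ := y ⬝ᵥ u / H u with hρ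
  have hmax : ∀ w, y ⬝ᵥ w ≤ ρ * H w := by
    intro w
    rcases eq_or_ne w 0 with rfl | hw
    · have h0 : piSupport A (0 : Fin n → ℝ) = 0 :=
        le_antisymm (hA.piSupport_le fun z _ => by simp) (hA.piSupport_nonneg _)
      simp [hH, h0, hs.ne']
    · have h1 : y ⬝ᵥ (‖w‖⁻¹ • w) / H (‖w‖⁻¹ • w) ≤ ρ :=
        hu (show ‖w‖⁻¹ • w ∈ Metric.sphere 0 1 by simp [norm_smul, hw])
      have hwn : 0 < ‖w‖⁻¹ := by positivity
      rw [dotProduct_smul, smul_eq_mul, hHsmul _ hwn, mul_div_mul_left _ _ hwn.ne'] at h1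
      exact (div_le_iff₀ (hHpos w hw)).1 h1
  have hρ1 : 1 < ρ := by
    by_contra! h
    have := mul_le_mul_of_nonneg_right h (hHpos v hv0).le
    linarith [hmax v]
  have hρ0 : 0 < ρ := by linarith
  -- the point of the boundary on the segment from the origin to `y`
  have hz : ρ⁻¹ • x ∈ A := by
    have h1 : ρ⁻¹ • y ∈ LogBM.piLogSum t A (LogBM.diagImage d A) := by
      intro w
      rw [smul_dotProduct, smul_eq_mul, inv_mul_le_iff₀ hρ0]
      exact hmax w
    rw [hC] at h1
    obtain ⟨x', hx', h⟩ := h1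
    convert hx'
    ext i
    have := congrFun h i
    simp only [Pi.mul_apply, Pi.smul_apply, hy, smul_eq_mul] at this ⊢
    refine mul_left_cancel₀ (hdt i).ne' ?_
    rw [this]
    ring
  set a : Fin n → ℝ := fun i => |u i| with ha
  have haabs : ∀ i, |a i| = |u i| := fun i => abs_abs _
  have ha0 : ∀ i, 0 ≤ a i := fun i => abs_nonneg _
  have hHa : H a = H u := by
    simp only [hH]
    rw [hA.piSupport_congr haabs, hB.piSupport_congr haabs]
  have hne : a ≠ 0 := by
    obtain ⟨i, hi⟩ := Function.ne_iff.1 hu0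
    exact Function.ne_iff.2 ⟨i, by simpa [ha] using hi⟩
  have heq : y ⬝ᵥ a = ρ * H a := by
    refine le_antisymm (hmax a) ?_
    rw [hHa, hρ, div_mul_cancel₀ _ (hHpos u hu0).ne']
    exact Finset.sum_le_sum fun i _ => mul_le_mul_of_nonneg_left (le_abs_self _)
      (mul_pos (hdt i) (hx0 i)).le
  set p : Fin n → ℝ := fun i => ρ⁻¹ * x i * a i with hp
  have hp0 : ∀ i, 0 ≤ p i := fun i =>
    mul_nonneg (mul_nonneg (inv_nonneg.2 hρ0.le) (hx0 i).le) (ha0 i)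
  have hpA : ∑ i, p i ≤ piSupport A a := hA.dotProduct_le hz a
  have hpB : ∑ i, d i * p i ≤ piSupport (LogBM.diagImage d A) a := by
    refine le_trans (le_of_eq ?_) (hB.dotProduct_le ⟨_, hz, rfl⟩ a)
    refine Finset.sum_congr rfl fun i _ => ?_
    simp only [hp, Pi.mul_apply, Pi.smul_apply, smul_eq_mul]
    ring
  have hpH : ∑ i, d i ^ t * p i = H a := by
    have : ∑ i, d i ^ t * p i = ρ⁻¹ * (y ⬝ᵥ a) := by
      simp only [dotProduct, hy, hp, Finset.mul_sum]
      exact Finset.sum_congr rfl fun i _ => by ring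
    rw [this, heq, inv_mul_cancel_left₀ hρ0.ne']
  have hps : 0 < ∑ i, p i := by
    obtain ⟨i, hi⟩ := Function.ne_iff.1 hne
    exact Finset.sum_pos' (fun j _ => hp0 j) ⟨i, Finset.mem_univ _,
      mul_pos (mul_pos (inv_pos.2 hρ0) (hx0 i)) (lt_of_le_of_ne (ha0 i) (Ne.symm hi))⟩
  obtain ⟨c, hc0, hc⟩ := eq_of_sum_rpow_mul_eq ht0 ht1 hd hp0 hps <| by
    rw [hpH]
    exact mul_le_mul (Real.rpow_le_rpow hps.le hpA hs.le)
      (Real.rpow_le_rpow (Finset.sum_nonneg fun i _ => mul_nonneg (hd i).le (hp0 i)) hpB ht0.le)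
      (Real.rpow_nonneg (Finset.sum_nonneg fun i _ => mul_nonneg (hd i).le (hp0 i)) _)
      (Real.rpow_nonneg (hA.piSupport_nonneg _) _)
  have hac : ∀ i, a i ≠ 0 → d i = c := fun i hi =>
    hc i (mul_ne_zero (mul_ne_zero (inv_ne_zero hρ0.ne') (hx0 i).ne') hi)
  have hda : d * a = c • a := by
    ext i
    by_cases hi : a i = 0
    · simp [hi]
    · simp [hac i hi]
  have hHa' : H a = c ^ t * piSupport A a := by
    have hA0 := hA.piSupport_pos hne
    simp only [hH]
    rw [hA.piSupport_diagImage hd, hda, hA.piSupport_smul hc0, Real.mul_rpow hc0.le hA0.le,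
      mul_left_comm, ← Real.rpow_add hA0]
    simp
  have hya : y ⬝ᵥ a = c ^ t * (x ⬝ᵥ a) := by
    simp only [dotProduct, hy, Finset.mul_sum]
    refine Finset.sum_congr rfl fun i _ => ?_
    by_cases hi : a i = 0
    · simp [hi]
    · rw [hac i hi]; ring
  have hxa : x ⬝ᵥ a ≤ piSupport A a := by
    obtain ⟨j, hj⟩ := Function.ne_iff.1 hne
    refine le_trans (le_of_eq ?_) (hA.dotProduct_le (hx j) a)
    refine Finset.sum_congr rfl fun i _ => ?_
    by_cases hi : a i = 0
    · simp [hi]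
    · simp [levelProj, hac i hi, hac j hj]
  have hct : 0 < c ^ t := Real.rpow_pos_of_pos hc0 t
  have h1 : x ⬝ᵥ a = ρ * piSupport A a := by
    refine mul_left_cancel₀ hct.ne' ?_
    rw [← hya, heq, hHa']
    ring
  nlinarith [hA.piSupport_pos hne]

theorem mem_of_levelProj_mem (hA : IsSolidBody A) (ht0 : 0 < t) (ht1 : t < 1)
    {d : Fin n → ℝ} (hd : ∀ i, 0 < d i)
    (hC : LogBM.piLogSum t A (LogBM.diagImage d A) = LogBM.diagImage (fun i => d i ^ t) A)
    {x : Fin n → ℝ} (hx : ∀ j, levelProj d (d j) x ∈ A) : x ∈ A := by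
  obtain ⟨r, hr, hrA⟩ := hA.exists_const_mem
  have h1 := mem_of_forall_Ioo hA.isCompact.isClosed (F := fun s i => s * |x i| + (1 - s) * r)
    (by fun_prop) fun s hs => by
      refine hA.mem_of_levelProj_mem_of_pos ht0 ht1 hd hC (fun i => ?_) fun j => ?_
      · have := mul_pos (sub_pos.2 hs.2) hr
        have := mul_nonneg hs.1.le (abs_nonneg (x i))
        linarith
      · refine hA.solid _ (hA.combination_mem hrA (hx j) hs.1.le hs.2.le) _ fun i => ?_
        simp only [levelProj]
        split_ifs
        · exact le_rfl
        · rw [abs_zero]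
          exact abs_nonneg _
  refine hA.solid _ h1 _ fun i => ?_
  simp

/-- The equality case of the log-Brunn–Minkowski inequality for unconditional bodies, in
coordinates. -/
theorem volume_piLogSum_eq_iff (hA : IsSolidBody A) (hB : IsSolidBody B) (ht0 : 0 < t)
    (ht1 : t < 1) :
    volume (LogBM.piLogSum t A B) = volume A ^ (1 - t) * volume B ^ t ↔
      ∃ d : Fin n → ℝ, (∀ i, 0 < d i) ∧ B = LogBM.diagImage d A ∧
        ∀ x, (∀ j, levelProj d (d j) x ∈ A) → x ∈ A := by
  have hs : 0 < 1 - t := by linarith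
  constructor
  · intro hv
    obtain ⟨d, hd, rfl⟩ := hA.eq_diagImage_of_volume_eq hB ht0 ht1 hv
    have hdt : ∀ i, 0 < d i ^ t := fun i => Real.rpow_pos_of_pos (hd i) t
    have hC := (hA.diagImage hdt).eq_of_subset_of_volume_eq (hA.piLogSum hB ht0 ht1)
      (hA.diagImage_rpow_subset_piLogSum ht0 ht1 hd)
      (hv.trans (volume_diagImage_rpow ht0 ht1 hd).symm)
    exact ⟨d, hd, rfl, fun x hx => hA.mem_of_levelProj_mem ht0 ht1 hd hC.symm hx⟩
  · rintro ⟨d, hd, rfl, hx⟩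
    rw [← volume_diagImage_rpow ht0 ht1 hd]
    congr 1
    refine Subset.antisymm (fun z hz => ?_) (hA.diagImage_rpow_subset_piLogSum ht0 ht1 hd)
    refine ⟨fun i => z i / d i ^ t, hx _ fun j => hA.mem_of_forall_le fun u => ?_, ?_⟩
    · have hdj : 0 < d j ^ t := Real.rpow_pos_of_pos (hd j) t
      -- On vectors supported in one level `d` acts as the scalar `d j`, so the product of support
      -- functions collapses to `d j ^ t` times that of `A`.
      have hle := hz (levelProj d (d j) u)
      have e : d * levelProj d (d j) u = d j • levelProj d (d j) u := by
        ext i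
        by_cases hi : d i = d j <;> simp [levelProj, hi]
      rw [hA.piSupport_diagImage hd, e, hA.piSupport_smul (hd j),
        Real.mul_rpow (hd j).le (hA.piSupport_nonneg _), mul_left_comm,
        ← Real.rpow_add' (hA.piSupport_nonneg _) (by simp), sub_add_cancel, Real.rpow_one,
        ← div_le_iff₀' hdj] at hle
      refine le_trans (le_of_eq ?_) (hle.trans (hA.piSupport_mono fun i => ?_))
      · simp only [dotProduct, Finset.sum_div]
        refine Finset.sum_congr rfl fun i _ => ?_
        by_cases hi : d i = d j
        · simp only [levelProj, hi, if_true]; ring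
        · simp [levelProj, hi]
      · by_cases hi : d i = d j <;> simp [levelProj, hi]
    · ext i
      exact mul_div_cancel₀ _ (Real.rpow_pos_of_pos (hd i) t).ne'

end IsSolidBody

/-! ### Passage to coordinates of the orthonormal basis -/

section

variable {n : ℕ}

/-- The coordinates with respect to an orthonormal basis. -/
noncomputable def coord (e : OrthonormalBasis (Fin n) ℝ (EuclideanSpace ℝ (Fin n))) :
    EuclideanSpace ℝ (Fin n) ≃L[ℝ] (Fin n → ℝ) :=
  e.repr.toContinuousLinearEquiv.trans (EuclideanSpace.equiv (Fin n) ℝ)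

variable {e : OrthonormalBasis (Fin n) ℝ (EuclideanSpace ℝ (Fin n))}
  {K L : Set (EuclideanSpace ℝ (Fin n))}

theorem coord_apply (x : EuclideanSpace ℝ (Fin n)) (i : Fin n) :
    coord e x i = inner ℝ (e i) x :=
  e.repr_apply_apply x i

theorem dotProduct_coord (x y : EuclideanSpace ℝ (Fin n)) :
    coord e x ⬝ᵥ coord e y = inner ℝ x y := by
  rw [← e.sum_inner_mul_inner x y]
  exact Finset.sum_congr rfl fun i _ => by rw [coord_apply, coord_apply, real_inner_comm]

theorem sum_coord_smul (x : EuclideanSpace ℝ (Fin n)) : ∑ i, coord e x i • e i = x :=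
  e.sum_repr x

theorem coord_basis (i j : Fin n) : coord e (e i) j = if j = i then 1 else 0 := by
  rw [coord_apply, orthonormal_iff_ite.1 e.orthonormal]

theorem volume_image_coord (S : Set (EuclideanSpace ℝ (Fin n))) :
    volume (coord e '' S) = volume S := by
  have mp : MeasurePreserving (coord e).toHomeomorph.toMeasurableEquiv volume volume :=
    (PiLp.volume_preserving_ofLp (Fin n)).comp e.measurePreserving_repr
  rw [← mp.measure_preimage_equiv]
  exact congrArg volume (preimage_image_eq S (coord e).injective)

theorem coord_reflection (i : Fin n) (x : EuclideanSpace ℝ (Fin n)) :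
    coord e ((Submodule.span ℝ {e i})ᗮ.reflection x)
      = Function.update (coord e x) i (-coord e x i) := by
  rw [Submodule.reflection_orthogonal_apply, Submodule.reflection_singleton_apply,
    e.norm_eq_one, ← coord_apply]
  ext j
  by_cases h : j = i
  · subst h
    simp [coord_basis]
    ring
  · simp [coord_basis, h]

theorem isSolid_image_coord (hK : Convex ℝ K) (hKe : IsUnconditional e K) :
    IsSolid (coord e '' K) := by
  have hA : Convex ℝ (coord e '' K) := hK.linear_image (coord e).toLinearEquiv.toLinearMap
  have flip : ∀ x ∈ coord e '' K, ∀ i, Function.update x i (-x i) ∈ coord e '' K := by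
    rintro _ ⟨x, hx, rfl⟩ i
    rw [← coord_reflection]
    exact ⟨_, (hKe i).subset ⟨x, hx, rfl⟩, rfl⟩
  have one : ∀ x ∈ coord e '' K, ∀ i, ∀ c : ℝ, |c| ≤ |x i| →
      Function.update x i c ∈ coord e '' K := by
    intro x hx i c hc
    rcases eq_or_ne (x i) 0 with h0 | h0
    · rw [h0, abs_zero] at hc
      rw [abs_nonpos_iff.1 hc, ← h0, Function.update_eq_self]
      exact hx
    · have hq : |c / x i| ≤ 1 := by
        rw [abs_div]
        exact div_le_one_of_le₀ hc (abs_nonneg _)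
      obtain ⟨h1, h2⟩ := abs_le.1 hq
      -- With `q = c / x i`, the weights `(1 + q) / 2` and `(1 - q) / 2` on `x i` and `-x i` average
      -- to `c`.
      have := hA hx (flip x hx i) (a := (1 + c / x i) / 2) (b := (1 - c / x i) / 2)
        (by linarith) (by linarith) (by ring)
      convert! this using 1
      ext j
      by_cases hj : j = i
      · subst hj
        simp only [Function.update_self, Pi.add_apply, Pi.smul_apply, smul_eq_mul]
        field_simp
        ring
      · simp [hj]
        ring
  intro x hx y hy
  have key : ∀ S : Finset (Fin n), (fun i => if i ∈ S then y i else x i) ∈ coord e '' K := by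
    intro S
    induction S using Finset.induction_on with
    | empty => simpa using hx
    | insert j S hj ih =>
      have := one _ ih j (y j) (by simpa [hj] using hy j)
      convert! this using 1
      ext i
      by_cases h : i = j
      · subst h; simp
      · simp [h]
  simpa using key Finset.univ

theorem isUnconditional_preimage_coord {A : Set (Fin n → ℝ)} (hA : IsSolid A) :
    IsUnconditional e (coord e ⁻¹' A) := by
  intro i
  have h : ∀ x, coord e x ∈ A → coord e ((Submodule.span ℝ {e i})ᗮ.reflection x) ∈ A := by
    intro x hx
    refine hA _ hx _ fun j => ?_
    rw [coord_reflection]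
    by_cases hj : j = i
    · subst hj; simp
    · simp [hj]
  ext x
  constructor
  · rintro ⟨y, hy, rfl⟩
    exact h y hy
  · intro hx
    exact ⟨_, h x hx, Submodule.reflection_reflection _ x⟩

theorem isSolidBody_image_coord (hK : IsConvexBody K) (hKe : IsUnconditional e K) :
    IsSolidBody (coord e '' K) where
  convex := hK.convex.linear_image (coord e).toLinearEquiv.toLinearMap
  isCompact := hK.isCompact.image (coord e).continuous
  solid := isSolid_image_coord hK.convex hKe
  exists_const_mem := by
    obtain ⟨x, hx⟩ := hK.interior_nonempty
    have ho : IsOpen (coord e '' interior K) := (coord e).toHomeomorph.isOpenMap _ isOpen_interior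
    obtain ⟨ε, hε, hball⟩ := Metric.isOpen_iff.1 ho _ ⟨x, hx, rfl⟩
    -- Pushing every coordinate of an interior point away from zero by `ε / 2` stays in the ball and
    -- makes all absolute values at least `ε / 2`; solidity then yields the constant point.
    refine ⟨ε / 2, by positivity, isSolid_image_coord hK.convex hKe
      (fun i => coord e x i + ε / 2 * if coord e x i < 0 then -1 else 1)
      (image_mono interior_subset (hball ?_)) _ fun i => ?_⟩
    · rw [Metric.mem_ball, dist_pi_lt_iff hε]
      intro i
      rw [Real.dist_eq, add_sub_cancel_left, abs_mul, abs_of_pos (half_pos hε)]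
      split_ifs <;> simp [hε]
    · rw [abs_of_pos (half_pos hε)]
      split_ifs with h
      · rw [abs_of_neg (by linarith)]; linarith
      · rw [abs_of_nonneg (by linarith)]; linarith

theorem supportFn_eq (K : Set (EuclideanSpace ℝ (Fin n))) (u : EuclideanSpace ℝ (Fin n)) :
    supportFn K u = piSupport (coord e '' K) (coord e u) := by
  simp only [supportFn, piSupport, image_image, dotProduct_coord]

/-- Both sides of the defining inequality are homogeneous of degree one in `u`, so unit vectors
suffice; at `u = 0` it holds trivially. -/
theorem image_coord_logSum (hA : IsSolidBody (coord e '' K)) (hB : IsSolidBody (coord e '' L))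
    (t : ℝ) : coord e '' logSum t K L = piLogSum t (coord e '' K) (coord e '' L) := by
  ext z
  obtain ⟨x, rfl⟩ := (coord e).surjective z
  rw [(coord e).injective.mem_set_image]
  constructor
  · intro hx v
    obtain ⟨u, rfl⟩ := (coord e).surjective v
    rcases eq_or_ne u 0 with rfl | hu
    · rw [map_zero, dotProduct_zero]
      exact mul_nonneg (Real.rpow_nonneg (hA.piSupport_nonneg _) _)
        (Real.rpow_nonneg (hB.piSupport_nonneg _) _)
    · have hn : 0 < ‖u‖ := norm_pos_iff.2 hu
      have h := hx (‖u‖⁻¹ • u) (by simp [norm_smul, hn.ne'])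
      rw [supportFn_eq (e := e), supportFn_eq (e := e), map_smul,
        hA.piSupport_smul (inv_pos.2 hn), hB.piSupport_smul (inv_pos.2 hn),
        Real.mul_rpow (inv_pos.2 hn).le (hA.piSupport_nonneg _),
        Real.mul_rpow (inv_pos.2 hn).le (hB.piSupport_nonneg _), mul_mul_mul_comm,
        ← Real.rpow_add (inv_pos.2 hn), sub_add_cancel, Real.rpow_one, inner_smul_right,
        ← dotProduct_coord (e := e)] at h
      exact le_of_mul_le_mul_left h (inv_pos.2 hn)
  · intro hx u _
    rw [supportFn_eq (e := e), supportFn_eq (e := e), ← dotProduct_coord (e := e)]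
    exact hx _

/-! ### Level parts and orthogonal decompositions -/

/-- The part of a set that lies in the span of the `e i` with `d i = c`. -/
def levelPart (e : OrthonormalBasis (Fin n) ℝ (EuclideanSpace ℝ (Fin n))) (A : Set (Fin n → ℝ))
    (d : Fin n → ℝ) (c : ℝ) : Set (EuclideanSpace ℝ (Fin n)) :=
  coord e ⁻¹' (A ∩ {a | ∀ i, d i ≠ c → a i = 0})

section levelPart

variable {A : Set (Fin n → ℝ)} {d : Fin n → ℝ}

theorem isSolid_levelPart (hA : IsSolidBody A) (c : ℝ) :
    IsSolid (A ∩ {a | ∀ i, d i ≠ c → a i = 0}) := by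
  intro x hx y hy
  refine ⟨hA.solid x hx.1 y hy, fun i hi => ?_⟩
  have := hy i
  rw [hx.2 i hi, abs_zero] at this
  exact abs_nonpos_iff.1 this

theorem levelPart_properties (hA : IsSolidBody A) (c : ℝ) :
    IsCompact (levelPart e A d c) ∧ Convex ℝ (levelPart e A d c) ∧
      IsUnconditional e (levelPart e A d c) := by
  have eq : {a : Fin n → ℝ | ∀ i, d i ≠ c → a i = 0} = ⋂ i, ⋂ (_ : d i ≠ c), {a | a i = 0} := by
    ext; simp
  refine ⟨?_, ?_, isUnconditional_preimage_coord (isSolid_levelPart hA c)⟩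
  · refine (coord e).toHomeomorph.isCompact_preimage.2 (hA.isCompact.inter_right ?_)
    rw [eq]
    exact isClosed_iInter fun i => isClosed_iInter fun _ =>
      isClosed_eq (continuous_apply i) continuous_const
  · refine Convex.linear_preimage (hA.convex.inter ?_) (coord e).toLinearEquiv.toLinearMap
    intro x hx y hy a b _ _ _ i hi
    simp [hx i hi, hy i hi]

theorem dim_levelPart (hA : IsSolidBody A) (c : ℝ) :
    dim (levelPart e A d c) = (Finset.univ.filter fun i => d i = c).card := by
  have hspan : vectorSpan ℝ (levelPart e A d c)
      = Submodule.span ℝ (Set.range fun i : {i // d i = c} => e i) := by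
    refine le_antisymm ?_ ?_
    · refine Submodule.span_le.2 ?_
      rintro _ ⟨x, hx, y, hy, rfl⟩
      simp only [vsub_eq_sub, SetLike.mem_coe]
      rw [← sum_coord_smul (e := e) (x - y)]
      refine Submodule.sum_mem _ fun i _ => ?_
      by_cases hi : d i = c
      · exact Submodule.smul_mem _ _ (Submodule.subset_span ⟨⟨i, hi⟩, rfl⟩)
      · have h1 : coord e x i = 0 := hx.2 i hi
        have h2 : coord e y i = 0 := hy.2 i hi
        simp [h1, h2]
    · refine Submodule.span_le.2 ?_
      rintro _ ⟨⟨i, hi⟩, rfl⟩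
      obtain ⟨r, hr, hrA⟩ := hA.exists_const_mem
      have h0 : (0 : EuclideanSpace ℝ (Fin n)) ∈ levelPart e A d c :=
        ⟨by rw [map_zero]; exact hA.zero_mem, fun i _ => by simp⟩
      have h1 : r • e i ∈ levelPart e A d c := by
        refine ⟨hA.solid _ hrA _ fun j => ?_, fun j hj => ?_⟩
        · rw [map_smul, Pi.smul_apply, coord_basis]
          split_ifs <;> simp
        · rw [map_smul, Pi.smul_apply, coord_basis, if_neg (by rintro rfl; exact hj hi)]
          simp
      have h2 := Submodule.smul_mem _ r⁻¹ (vsub_mem_vectorSpan ℝ h1 h0)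
      rwa [vsub_eq_sub, sub_zero, inv_smul_smul₀ hr.ne'] at h2
  have hli : LinearIndependent ℝ fun i : {i // d i = c} => e i :=
    e.orthonormal.linearIndependent.comp _ Subtype.val_injective
  rw [dim, hspan, finrank_span_eq_card hli, Fintype.card_subtype]

theorem isOrthogonalSum_levelPart (hA : IsSolidBody A) {m : ℕ} {c : Fin m → ℝ}
    (hc : Function.Injective c) (hcd : ∀ i, ∃ k, c k = d i)
    (hstar : ∀ x, (∀ j, levelProj d (d j) x ∈ A) → x ∈ A) :
    IsOrthogonalSum (coord e ⁻¹' A) fun k => levelPart e A d (c k) := by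
  refine ⟨fun k l hkl => ?_, ?_⟩
  · refine Submodule.isOrtho_span.2 fun x hx y hy => ?_
    rw [← dotProduct_coord (e := e)]
    refine Finset.sum_eq_zero fun i _ => ?_
    by_cases hi : d i = c k
    · rw [hy.2 i fun h => hkl (hc (hi.symm.trans h)), mul_zero]
    · rw [hx.2 i hi, zero_mul]
  · ext x
    rw [Set.mem_fintype_sum]
    constructor
    · intro hx
      refine ⟨fun k => (coord e).symm (levelProj d (c k) (coord e x)), fun k => ⟨?_, ?_⟩, ?_⟩
      · rw [ContinuousLinearEquiv.apply_symm_apply]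
        refine hA.solid _ hx _ fun i => ?_
        by_cases hi : d i = c k <;> simp [levelProj, hi]
      · intro i hi
        rw [ContinuousLinearEquiv.apply_symm_apply]
        simp [levelProj, hi]
      · apply (coord e).injective
        rw [map_sum]
        simp only [ContinuousLinearEquiv.apply_symm_apply]
        ext i
        obtain ⟨k, hk⟩ := hcd i
        rw [Finset.sum_apply, Finset.sum_eq_single k]
        · simp [levelProj, hk]
        · intro l _ hl
          simp [levelProj, ← hk, hc.ne hl.symm]
        · simp
    · rintro ⟨g, hg, rfl⟩
      refine hstar _ fun j => ?_
      obtain ⟨k, hk⟩ := hcd j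
      have : levelProj d (d j) (coord e (∑ k, g k)) = coord e (g k) := by
        ext i
        simp only [levelProj, map_sum, Finset.sum_apply]
        by_cases hi : d i = d j
        · rw [if_pos hi, Finset.sum_eq_single k]
          · intro l _ hl
            exact (hg l).2 i fun h => hl (hc (by rw [hk, ← hi, h]))
          · simp
        · rw [if_neg hi]
          exact ((hg k).2 i (by rwa [hk])).symm
      rw [this]
      exact (hg k).1

theorem mem_diagImage_iff (hd : ∀ i, 0 < d i) {y : Fin n → ℝ} :
    y ∈ diagImage d A ↔ (fun i => y i / d i) ∈ A := by
  constructor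
  · rintro ⟨x, hx, rfl⟩
    convert hx with i
    exact mul_div_cancel_left₀ _ (hd i).ne'
  · intro h
    refine ⟨_, h, ?_⟩
    ext i
    exact mul_div_cancel₀ _ (hd i).ne'

theorem areDilates_levelPart (hd : ∀ i, 0 < d i) {c : ℝ} (hc : 0 < c) :
    AreDilates (levelPart e A d c) (levelPart e (diagImage d A) d c) := by
  refine ⟨c, hc, ?_⟩
  ext y
  rw [Set.mem_smul_set_iff_inv_smul_mem₀ hc.ne']
  simp only [levelPart, mem_preimage, mem_inter_iff, mem_ofPred_eq, map_smul, Pi.smul_apply,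
    smul_eq_mul, mul_eq_zero, inv_eq_zero, hc.ne', false_or, mem_diagImage_iff hd]
  refine and_congr_left fun h => ?_
  have : (fun i => coord e y i / d i) = c⁻¹ • coord e y := by
    ext i
    by_cases hi : d i = c
    · rw [hi, Pi.smul_apply, smul_eq_mul, div_eq_inv_mul]
    · simp [h i hi]
  rw [this]

theorem mem_diagImage_of_levelProj (hd : ∀ i, 0 < d i)
    (hstar : ∀ x, (∀ j, levelProj d (d j) x ∈ A) → x ∈ A) (y : Fin n → ℝ)
    (hy : ∀ j, levelProj d (d j) y ∈ diagImage d A) : y ∈ diagImage d A := by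
  rw [mem_diagImage_iff hd]
  refine hstar _ fun j => ?_
  have := (mem_diagImage_iff hd).1 (hy j)
  convert! this using 1
  ext i
  by_cases hi : d i = d j <;> simp [levelProj, hi]

end levelPart

theorem exists_decomposition (hn : 1 ≤ n) (hA : IsSolidBody (coord e '' K))
    {d : Fin n → ℝ} (hd : ∀ i, 0 < d i) (hB : coord e '' L = diagImage d (coord e '' K))
    (hstar : ∀ x, (∀ j, levelProj d (d j) x ∈ coord e '' K) → x ∈ coord e '' K) :
    ∃ (m : ℕ) (P Q : Fin m → Set (EuclideanSpace ℝ (Fin n))),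
      1 ≤ m ∧ IsOrthogonalSum K P ∧ IsOrthogonalSum L Q ∧
      (∀ i, IsCompact (P i) ∧ Convex ℝ (P i) ∧ IsUnconditional e (P i) ∧ 1 ≤ dim (P i)) ∧
      (∀ i, IsCompact (Q i) ∧ Convex ℝ (Q i) ∧ IsUnconditional e (Q i) ∧ 1 ≤ dim (Q i)) ∧
      ∑ i, dim (P i) = n ∧ ∀ i, AreDilates (P i) (Q i) := by
  set A := coord e '' K with hAK
  have hK : K = coord e ⁻¹' A := (preimage_image_eq K (coord e).injective).symm
  have hL : L = coord e ⁻¹' diagImage d A := by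
    rw [← hB, preimage_image_eq L (coord e).injective]
  set I := Finset.univ.image d with hI
  -- The summands are indexed by the distinct values of `d`, and these values are the dilation
  -- factors.
  set c : Fin I.card → ℝ := fun k => (I.equivFin.symm k : ℝ) with hc
  have hinj : Function.Injective c := Subtype.val_injective.comp I.equivFin.symm.injective
  have hmem : ∀ k, ∃ i, d i = c k := fun k => by
    obtain ⟨i, -, hi⟩ := Finset.mem_image.1 (I.equivFin.symm k).2
    exact ⟨i, hi⟩
  have hcd : ∀ i, ∃ k, c k = d i := fun i =>
    ⟨I.equivFin ⟨d i, Finset.mem_image_of_mem d (Finset.mem_univ i)⟩, by simp [hc]⟩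
  have hpos : ∀ {D : Set (Fin n → ℝ)}, IsSolidBody D → ∀ k, 1 ≤ dim (levelPart e D d (c k)) := by
    intro D hD k
    rw [dim_levelPart hD, Nat.one_le_iff_ne_zero, Finset.card_ne_zero]
    obtain ⟨i, hi⟩ := hmem k
    exact ⟨i, by simpa using hi⟩
  refine ⟨I.card, fun k => levelPart e A d (c k), fun k => levelPart e (diagImage d A) d (c k),
    ?_, ?_, ?_, fun k => ?_, fun k => ?_, ?_, fun k => ?_⟩
  · exact Finset.card_pos.2 ⟨_, Finset.mem_image_of_mem d (Finset.mem_univ ⟨0, hn⟩)⟩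
  · rw [hK]
    exact isOrthogonalSum_levelPart hA hinj hcd hstar
  · rw [hL]
    exact isOrthogonalSum_levelPart (hA.diagImage hd) hinj hcd (mem_diagImage_of_levelProj hd hstar)
  · obtain ⟨h1, h2, h3⟩ := levelPart_properties (e := e) (d := d) hA (c k)
    exact ⟨h1, h2, h3, hpos hA k⟩
  · obtain ⟨h1, h2, h3⟩ := levelPart_properties (e := e) (d := d) (hA.diagImage hd) (c k)
    exact ⟨h1, h2, h3, hpos (hA.diagImage hd) k⟩
  · simp only [dim_levelPart hA]
    have h := Finset.card_eq_sum_card_image d Finset.univ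
    rw [Finset.card_univ, Fintype.card_fin] at h
    refine Eq.trans ?_ h.symm
    rw [← hI, ← Finset.sum_coe_sort I]
    exact Equiv.sum_comp I.equivFin.symm
      fun b : I => (Finset.univ.filter fun i => d i = (b : ℝ)).card
  · obtain ⟨i, hi⟩ := hmem k
    exact areDilates_levelPart hd (hi ▸ hd i)

theorem exists_diagImage_of_decomposition (hA : IsSolidBody (coord e '' K)) {m : ℕ}
    {P Q : Fin m → Set (EuclideanSpace ℝ (Fin n))} (hKP : IsOrthogonalSum K P)
    (hLQ : IsOrthogonalSum L Q)
    (hP : ∀ i, Convex ℝ (P i) ∧ IsUnconditional e (P i) ∧ 1 ≤ dim (P i))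
    (hPQ : ∀ i, AreDilates (P i) (Q i)) :
    ∃ d : Fin n → ℝ, (∀ i, 0 < d i) ∧ coord e '' L = diagImage d (coord e '' K) ∧
      ∀ x, (∀ j, levelProj d (d j) x ∈ coord e '' K) → x ∈ coord e '' K := by
  have hsol : ∀ i, IsSolid (coord e '' P i) := fun i => isSolid_image_coord (hP i).1 (hP i).2.1
  choose c hc0 hcQ using hPQ
  have hsum : ∀ x, x ∈ K ↔ ∃ g : Fin m → _, ∃ (_ : ∀ i, g i ∈ P i), ∑ i, g i = x := fun x => by
    conv_lhs => rw [hKP.2]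
    exact Set.mem_fintype_sum _ _
  have hsumL : ∀ x, x ∈ L ↔ ∃ g : Fin m → _, ∃ (_ : ∀ i, g i ∈ Q i), ∑ i, g i = x := fun x => by
    conv_lhs => rw [hLQ.2]
    exact Set.mem_fintype_sum _ _
  -- the summand that meets the `j`-th coordinate axis
  have hσ : ∀ j, ∃ i, ∃ w ∈ P i, coord e w j ≠ 0 := by
    intro j
    obtain ⟨r, hr, x, hx, hxr⟩ := hA.exists_const_mem
    obtain ⟨g, hg, rfl⟩ := (hsum x).1 hx
    have : ∑ i, coord e (g i) j ≠ 0 := by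
      have := congrFun hxr j
      rw [map_sum, Finset.sum_apply] at this
      rw [this]
      exact hr.ne'
    obtain ⟨i, -, hi⟩ := Finset.exists_ne_zero_of_sum_ne_zero this
    exact ⟨i, g i, hg i, hi⟩
  choose σ w hw hwj using hσ
  -- By solidity `P (σ j)` contains a nonzero vector on the `j`-th axis; the other summands are
  -- orthogonal to it.
  have hzero : ∀ i j, σ j ≠ i → ∀ p ∈ P i, coord e p j = 0 := by
    intro i j hij p hp
    obtain ⟨v, hv, hve⟩ := hsol (σ j) _ ⟨_, hw j, rfl⟩ (Pi.single j (coord e (w j) j)) fun l => by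
      by_cases hl : l = j
      · subst hl; simp
      · simp [hl]
    have h := Submodule.isOrtho_span.1 (hKP.1 hij) hv hp
    rw [← dotProduct_coord (e := e), hve, single_dotProduct] at h
    exact (mul_eq_zero.1 h).resolve_left (hwj j)
  have hcoord : ∀ g : Fin m → EuclideanSpace ℝ (Fin n), (∀ i, g i ∈ P i) → ∀ j,
      coord e (∑ i, g i) j = coord e (g (σ j)) j := by
    intro g hg j
    rw [map_sum, Finset.sum_apply, Finset.sum_eq_single (σ j)]
    · exact fun i _ hi => hzero i j hi.symm _ (hg i)
    · simp
  have hdcoord : ∀ g : Fin m → EuclideanSpace ℝ (Fin n), (∀ i, g i ∈ P i) →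
      coord e (∑ i, c i • g i) = (fun j => c (σ j)) * coord e (∑ i, g i) := by
    intro g hg
    ext j
    rw [Pi.mul_apply, hcoord g hg, map_sum, Finset.sum_apply, Finset.sum_eq_single (σ j)]
    · simp
    · intro i _ hi
      simp [hzero i j hi.symm _ (hg i)]
    · simp
  refine ⟨fun j => c (σ j), fun j => hc0 _, ?_, fun x hx => ?_⟩
  · ext z
    constructor
    · rintro ⟨y, hy, rfl⟩
      obtain ⟨g, hg, rfl⟩ := (hsumL y).1 hy
      simp only [hcQ, Set.mem_smul_set] at hg
      choose f hf hfg using hg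
      refine ⟨_, ⟨_, (hsum _).2 ⟨f, hf, rfl⟩, rfl⟩, ?_⟩
      simp only [← hdcoord f hf, hfg]
    · rintro ⟨_, ⟨x, hx, rfl⟩, rfl⟩
      obtain ⟨g, hg, rfl⟩ := (hsum x).1 hx
      refine ⟨∑ i, c i • g i, (hsumL _).2 ⟨_, fun i => ?_, rfl⟩, hdcoord g hg⟩
      rw [hcQ]
      exact Set.smul_mem_smul_set (hg i)
  · have hpart : ∀ i, ∃ p ∈ P i, coord e p = fun l => if σ l = i then x l else 0 := by
      intro i
      by_cases hi : ∃ j, σ j = i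
      · obtain ⟨j, rfl⟩ := hi
        -- Different summands may share a dilation factor, so a level of `d` may comprise several
        -- blocks; the block `σ j` is extracted by decomposing the level projection.
        obtain ⟨y, hy, hyx⟩ := hx j
        obtain ⟨g, hg, rfl⟩ := (hsum y).1 hy
        refine ⟨g (σ j), hg _, ?_⟩
        ext l
        split_ifs with hl
        · have := congrFun hyx l
          rw [hcoord g hg, hl] at this
          simpa [levelProj, hl] using this
        · exact hzero _ _ hl _ (hg _)
      -- For a block without coordinates only the zero vector is needed; `1 ≤ dim (P i)` gives
      -- nonemptiness and solidity gives zero.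
      · obtain ⟨p, hp⟩ : (P i).Nonempty := by
          by_contra h
          have := (hP i).2.2
          rw [Set.not_nonempty_iff_eq_empty.1 h] at this
          simp [dim] at this
        obtain ⟨q, hq, hq0⟩ := hsol i _ ⟨p, hp, rfl⟩ 0 (by simp)
        refine ⟨q, hq, ?_⟩
        rw [hq0]
        ext l
        rw [if_neg fun h => hi ⟨l, h⟩, Pi.zero_apply]
    choose p hp hpx using hpart
    refine ⟨_, (hsum _).2 ⟨p, hp, rfl⟩, ?_⟩
    ext j
    rw [hcoord p hp, hpx]
    simp

end

end LogBM

theorem proposition7p6 {n : ℕ} (hn : 1 ≤ n)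
    (e : OrthonormalBasis (Fin n) ℝ (EuclideanSpace ℝ (Fin n)))
    (K L : Set (EuclideanSpace ℝ (Fin n)))
    (hK : LogBM.IsConvexBody K) (hL : LogBM.IsConvexBody L)
    (hKe : LogBM.IsUnconditional e K) (hLe : LogBM.IsUnconditional e L)
    (t : ℝ) (ht0 : 0 < t) (ht1 : t < 1) :
    MeasureTheory.volume (LogBM.logSum t K L) =
        MeasureTheory.volume K ^ (1 - t) * MeasureTheory.volume L ^ t ↔
      ∃ (m : ℕ) (P Q : Fin m → Set (EuclideanSpace ℝ (Fin n))),
        1 ≤ m ∧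
        LogBM.IsOrthogonalSum K P ∧ LogBM.IsOrthogonalSum L Q ∧
        (∀ i, IsCompact (P i) ∧ Convex ℝ (P i) ∧ LogBM.IsUnconditional e (P i) ∧
          1 ≤ LogBM.dim (P i)) ∧
        (∀ i, IsCompact (Q i) ∧ Convex ℝ (Q i) ∧ LogBM.IsUnconditional e (Q i) ∧
          1 ≤ LogBM.dim (Q i)) ∧
        ∑ i, LogBM.dim (P i) = n ∧
        ∀ i, LogBM.AreDilates (P i) (Q i) := by
  have hA := LogBM.isSolidBody_image_coord hK hKe
  have hB := LogBM.isSolidBody_image_coord hL hLe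
  rw [← LogBM.volume_image_coord (e := e) (LogBM.logSum t K L),
    ← LogBM.volume_image_coord (e := e) K, ← LogBM.volume_image_coord (e := e) L,
    LogBM.image_coord_logSum hA hB, hA.volume_piLogSum_eq_iff hB ht0 ht1]
  constructor
  · rintro ⟨d, hd, hdB, hstar⟩
    exact LogBM.exists_decomposition hn hA hd hdB hstar
  · rintro ⟨m, P, Q, -, hKP, hLQ, hP, -, -, hPQ⟩
    exact LogBM.exists_diagImage_of_decomposition hA hKP hLQ (fun i => (hP i).2) hPQ
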